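/- Work in the Clifford (geometric) algebra $Cl_n$ of Euclidean space $\mathbb R^n$, with $\widetilde{X}$ the reverse of $X$, $\langle X\rangle_k$ the grade-$k$ part and $|X|=\sqrt{\langle X\widetilde X\rangle_0}$. A normed $k$-blade is an outer product of $k$ vectors of magnitude $1$; a blade $D$ represents the subspace $\{x\in\mathbb R^n: x\wedge D=0\}$. Let $q,r\ge 0$, let $A$ be a normed $(r+q)$-blade and $B$ a normed $r$-blade, and let $A=A_1A_2$ with a normed $q$-blade $A_1$ and a normed $r$-blade $A_2$, where $A_1\perp A_2$ and $A_1\perp B$ (that is, every vector $x$ with $x\rfloor A_1=xA_1$ satisfies $x\rfloor A_2=x\rfloor B=0$). Let $\mathsf A,\mathsf A_2,\mathsf B$ be the subspaces of $A,A_2,B$. Principal vectors for $(\mathsf A_2,\mathsf B)$ are orthonormal bases $a_1,\dots,a_r$ of $\mathsf A_2$ and $b_1,\dots,b_r$ of $\mathsf B$ with $a_k\cdot b_l=0$ for $k\ne l$ and $a_k\cdot b_k\ge 0$; the principal angles are $\theta_k=\angle(a_k,b_k)\in[0,\pi/2]$. Write $c_k=\cos\theta_k$, $s_k=\sin\theta_k$,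 and $\mathbf i_k=(a_k\wedge b_k)/s_k$ when $\theta_k\neq 0$. Let $Z,M,P$ be the sets of indices $k$ with $\theta_k=0$, $0<\theta_k<\pi/2$, $\theta_k=\pi/2$ respectively, $s=|Z|$, $t=|P|$, and $\mathbf i_S=\prod_{k\in S}\mathbf i_k$ (factors in increasing order of $k$). (If the angles are listed increasingly, then $Z=\{1,\dots,s\}$, $M=\{s+1,\dots,r-t\}$, $P=\{r-t+1,\dots,r\}$.) Principal vectors exist, and for every choice of them the following holds. 1. There is a sign $\varepsilon\in\{1,-1\}$ with $$A\widetilde B=\varepsilon\,A_1\Big(\sum_{S\subseteq M}\ \prod_{k\in S}s_k\prod_{k\in M\setminus S}c_k\ \mathbf i_S\Big)\,\mathbf i_P .$$ If $\langle A_2\widetilde B\rangle_0\ge 0$, the principal vectors can be chosen such that this holds with $\varepsilon=1$. 2. $s=\dim(\mathsf A\cap\mathsf B)$, and $t$ is independent of the choice of the factorization: for any other factorization $A=A_1'A_2'$ as above and any principal vectors for $(\mathsf A_2',\mathsf B)$, the number of principal angles $\pi/2$ is again $t$. 3. The lowest non-zero grade part of $A\widetilde B$ has grade $2t+q$; it is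 $L=\varepsilon\,\big(\prod_{k\in M}c_k\big)A_1\mathbf i_P$, with the $\varepsilon$ of part 1, and has magnitude $\cos\theta_{\mathsf A\mathsf B}:=\prod_{k\in M}c_k$. 4. The highest non-zero grade part of $A\widetilde B$ has grade $2(r-s)+q$ and magnitude $\prod_{k\in M}s_k$. 5. $L$ is invertible and $W:=A\widetilde B\,L^{-1}=L^{-1}A\widetilde B$ has scalar part $1$, maximal non-zero grade $2(r-t-s)$, and bivector part $$F=\langle W\rangle_2=\sum_{k\in M}\tan\theta_k\ \mathbf i_k .$$ From $F$ the principal angles $\theta_k$, $k\in M$, are read off: the sum above is a splitting of $F$ into positive multiples of unit $2$-blades in mutually orthogonal planes, and for any such splitting $F=\sum_j\tau_jJ_j$ (with $\tau_j>0$ and $J_j=u_j\wedge v_j$, all the $u_j,v_j$ together orthonormal) the multiset of the numbers $\arctan\tau_j$ equals the multiset of the $\theta_k$, $k\in M$. -/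

import Mathlib

open scoped RealInnerProductSpace

noncomputable section

namespace SubspaceAngles

/-- Euclidean space of dimension `n`. -/
abbrev V (n : ℕ) : Type := EuclideanSpace ℝ (Fin n)

/-- The Euclidean quadratic form `x ↦ ⟪x, x⟫`. -/
abbrev Q (n : ℕ) : QuadraticForm ℝ (V n) := LinearMap.BilinMap.toQuadraticMap (innerₗ (V n))

/-- The Clifford (geometric) algebra of Euclidean `n`-space; its product is the geometric
product. -/
abbrev Cl (n : ℕ) : Type := CliffordAlgebra (Q n)

instance invertibleTwo : Invertible (2 : ℝ) := invertibleOfNonzero two_ne_zero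

variable {n : ℕ}

/-- The canonical linear identification of the Clifford algebra with the Grassmann algebra
(a product of mutually orthogonal vectors corresponds to their outer product). -/
def toGrassmann (n : ℕ) : Cl n ≃ₗ[ℝ] ExteriorAlgebra ℝ (V n) :=
  CliffordAlgebra.equivExterior (Q n)

/-- The grade-`k` part `⟨X⟩ₖ` of a multivector. -/
def gradePart (k : ℕ) (X : Cl n) : Cl n :=
  (toGrassmann n).symm
    (GradedAlgebra.proj (fun i : ℕ => ⋀[ℝ]^i (V n)) k (toGrassmann n X))

/-- The scalar part `⟨X⟩₀`, as a real number. -/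
def scalarPart (X : Cl n) : ℝ := ExteriorAlgebra.algebraMapInv (toGrassmann n X)

/-- The magnitude of a multivector, `|X|² = ⟨X X̃⟩₀`. -/
def magnitude (X : Cl n) : ℝ := Real.sqrt (scalarPart (X * CliffordAlgebra.reverse X))

/-- The outer product `v₁ ∧ ⋯ ∧ vᵣ` of vectors, as an element of the Clifford algebra. -/
def outer {r : ℕ} (v : Fin r → V n) : Cl n :=
  (toGrassmann n).symm (ExteriorAlgebra.ιMulti ℝ r v)

/-- `X` is a normed `r`-blade: an outer product of `r` vectors, of magnitude one. -/
def IsNormedBlade (r : ℕ) (X : Cl n) : Prop :=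
  (∃ v : Fin r → V n, X = outer v) ∧ magnitude X = 1

/-- The subspace `{x | x ∧ X = 0}` represented by a blade `X`. -/
def bladeSpace (X : Cl n) : Submodule ℝ (V n) where
  carrier := {x | ExteriorAlgebra.ι ℝ x * toGrassmann n X = 0}
  add_mem' := by
    intro x y hx hy
    simp only [Set.mem_ofPred_eq] at hx hy ⊢
    rw [map_add, add_mul, hx, hy, add_zero]
  zero_mem' := by simp
  smul_mem' := by
    intro c x hx
    simp only [Set.mem_ofPred_eq] at hx ⊢
    rw [map_smul, smul_mul_assoc, hx, smul_zero]

/-- The left contraction `x ⌋ X` of a multivector by a vector. -/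
def contract (x : V n) (X : Cl n) : Cl n :=
  CliffordAlgebra.contractLeft (innerₗ (V n) x) X

/-- Orthogonality of blades, `X ⊥ Y`: every vector `x` with `x ⌋ X = x X` has `x ⌋ Y = 0`. -/
def BladeOrthogonal (X Y : Cl n) : Prop :=
  ∀ x : V n, contract x X = CliffordAlgebra.ι (Q n) x * X → contract x Y = 0

/-- `A = A₁ A₂` with normed blades `A₁` of grade `q` and `A₂` of grade `r`, where `A₁` is
orthogonal to both `A₂` and `B`. -/
structure IsFactorization (q r : ℕ) (A B A₁ A₂ : Cl n) : Prop where
  normed_left : IsNormedBlade q A₁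
  normed_right : IsNormedBlade r A₂
  eq_mul : A = A₁ * A₂
  orth_right : BladeOrthogonal A₁ A₂
  orth_blade : BladeOrthogonal A₁ B

/-- `a`, `b` are principal vectors of the `r`-dimensional subspaces `U`, `W`: orthonormal bases
such that the pairs `aₖ, bₖ` span mutually orthogonal lines or planes and enclose an angle
of at most `π / 2`. -/
structure IsPrincipalSystem {r : ℕ} (U W : Submodule ℝ (V n)) (a b : Fin r → V n) : Prop where
  orthonormal_left : Orthonormal ℝ a
  orthonormal_right : Orthonormal ℝ b
  span_left : Submodule.span ℝ (Set.range a) = U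
  span_right : Submodule.span ℝ (Set.range b) = W
  inner_ne : ∀ k l, k ≠ l → ⟪a k, b l⟫ = 0
  inner_nonneg : ∀ k, 0 ≤ ⟪a k, b k⟫

/-- The principal angle `θₖ` between `aₖ` and `bₖ`. -/
def ang {r : ℕ} (a b : Fin r → V n) (k : Fin r) : ℝ := InnerProductGeometry.angle (a k) (b k)

/-- The unit bivector `𝐢ₖ = (aₖ ∧ bₖ) / sin θₖ` of the `k`-th principal plane; it is used only
for `θₖ ≠ 0`. -/
def planeBivector {r : ℕ} (a b : Fin r → V n) (k : Fin r) : Cl n :=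
  (Real.sin (ang a b k))⁻¹ • outer ![a k, b k]

open Classical in
/-- Indices of vanishing principal angles (`k ≤ s` in increasing order of the angles). -/
def parIdx {r : ℕ} (a b : Fin r → V n) : Finset (Fin r) :=
  Finset.univ.filter fun k => ang a b k = 0

open Classical in
/-- Indices of principal angles `π / 2` (`r - t < k` in increasing order of the angles). -/
def perpIdx {r : ℕ} (a b : Fin r → V n) : Finset (Fin r) :=
  Finset.univ.filter fun k => ang a b k = Real.pi / 2

open Classical in
/-- Indices of the other principal angles (`s < k ≤ r - t` in increasing order). -/
def midIdx {r : ℕ} (a b : Fin r → V n) : Finset (Fin r) :=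
  Finset.univ.filter fun k => 0 < ang a b k ∧ ang a b k < Real.pi / 2

/-- The geometric product of the unit bivectors `𝐢ₖ`, `k ∈ S`, in increasing order of `k`. -/
def planeProd {r : ℕ} (a b : Fin r → V n) (S : Finset (Fin r)) : Cl n :=
  ((S.sort (· ≤ ·)).map (planeBivector a b)).prod

/-- The expanded product of rotors
`(c ⋯ c + s c ⋯ c 𝐢 + ⋯ + s ⋯ s 𝐢 ⋯ 𝐢)` over the principal angles strictly between `0` and
`π / 2`, times the product of the unit bivectors of the principal angles `π / 2`: the term of
`S` has a sine and a bivector for each index in `S`, and a cosine for each other index. -/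
def rotorSum {r : ℕ} (a b : Fin r → V n) : Cl n :=
  (∑ S ∈ (midIdx a b).powerset,
    ((∏ k ∈ S, Real.sin (ang a b k)) * ∏ k ∈ midIdx a b \ S, Real.cos (ang a b k)) •
      planeProd a b S) * planeProd a b (perpIdx a b)

/-- `F = ∑ⱼ τⱼ Jⱼ` splits the bivector `F` into positive multiples of unit 2-blades `Jⱼ` in
mutually orthogonal planes. -/
def IsSplitting {κ : Type} [Fintype κ] (F : Cl n) (τ : κ → ℝ) (J : κ → Cl n) : Prop :=
  (∃ u v : κ → V n, Orthonormal ℝ (Sum.elim u v) ∧ ∀ j, J j = outer ![u j, v j]) ∧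
    (∀ j, 0 < τ j) ∧ F = ∑ j, τ j • J j

end SubspaceAngles

end

/-!
For principal bases, `a₁ ⋯ aᵣ bᵣ ⋯ b₁` reorders into the product of the commuting plane rotors
`aₖ bₖ = cos θₖ + sin θₖ 𝐢ₖ`, and `A₂ B̃` equals it up to orientation. Expanding over the subsets
`S` of the angles strictly between `0` and `π / 2` writes `A B̃` as a combination of normed blades
of grades `2 t + q + 2 |S|`, with nonzero coefficients; `S = ∅` and the full set give the lowest
and the highest grade part. Dividing by the lowest part leaves `∏ (1 + tan θₖ 𝐢ₖ)`, whose bivector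
part is `F = ∑ tan θₖ 𝐢ₖ`.

For an orthogonal splitting `F = ∑ τⱼ uⱼ ∧ vⱼ`, minus the square of the skew map `x ↦ x ⌋ F` is
diagonal in the vectors `uⱼ, vⱼ`, with eigenvalues `τⱼ²`; hence `F` determines the multiset of the
`τⱼ`.
-/

noncomputable section

namespace SubspaceAngles

section Clifford

open CliffordAlgebra

variable {R M κ : Type*} [CommRing R] [AddCommGroup M] [Module R M] {Q : QuadraticForm R M}

lemma contractLeft_list_prod_eq_zero {d : Module.Dual R M} {l : List M} (h : ∀ x ∈ l, d x = 0) :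
    contractLeft d (l.map (ι Q)).prod = 0 := by
  induction l with
  | nil => simp
  | cons x l ih =>
    rw [List.forall_mem_cons] at h
    rw [List.map_cons, List.prod_cons, contractLeft_ι_mul, h.1, ih h.2, zero_smul, mul_zero,
      sub_zero]

lemma list_prod_mul_reverse {l : List M} (h : ∀ x ∈ l, Q x = 1) :
    (l.map (ι Q)).prod * reverse (l.map (ι Q)).prod = 1 := by
  induction l with
  | nil => simp
  | cons x l ih =>
    rw [List.forall_mem_cons] at h
    rw [List.map_cons, List.prod_cons, reverse.map_mul, reverse_ι, mul_assoc,
      ← mul_assoc (l.map (ι Q)).prod, ih h.2, one_mul, ι_sq_scalar, h.1, map_one]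

lemma reverse_mul_list_prod {l : List M} (h : ∀ x ∈ l, Q x = 1) :
    reverse (l.map (ι Q)).prod * (l.map (ι Q)).prod = 1 := by
  induction l with
  | nil => simp
  | cons x l ih =>
    rw [List.forall_mem_cons] at h
    rw [List.map_cons, List.prod_cons, reverse.map_mul, reverse_ι, mul_assoc,
      ← mul_assoc (ι Q x), ι_sq_scalar, h.1, map_one, one_mul, ih h.2]

lemma ι_mul_list_prod_of_isOrtho {x : M} {l : List M} (h : ∀ y ∈ l, Q.IsOrtho x y) :
    ι Q x * (l.map (ι Q)).prod = (-1 : R) ^ l.length • ((l.map (ι Q)).prod * ι Q x) := by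
  induction l with
  | nil => simp
  | cons y l ih =>
    rw [List.forall_mem_cons] at h
    rw [List.map_cons, List.prod_cons, ← mul_assoc, ι_mul_ι_comm_of_isOrtho h.1, neg_mul, mul_assoc,
      ih h.2, mul_smul_comm, List.length_cons, pow_succ, mul_neg_one, neg_smul, mul_assoc]

lemma list_prod_mul_list_prod_of_isOrtho {l l' : List M} (h : ∀ x ∈ l, ∀ y ∈ l', Q.IsOrtho x y) :
    (l.map (ι Q)).prod * (l'.map (ι Q)).prod =
      (-1 : R) ^ (l.length * l'.length) • ((l'.map (ι Q)).prod * (l.map (ι Q)).prod) := by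
  induction l with
  | nil => simp
  | cons x l ih =>
    rw [List.forall_mem_cons] at h
    rw [List.map_cons, List.prod_cons, mul_assoc, ih h.2, mul_smul_comm, ← mul_assoc,
      ι_mul_list_prod_of_isOrtho h.1, smul_mul_assoc, smul_smul, mul_assoc, List.length_cons,
      add_mul, one_mul, pow_add]

lemma list_prod_mul_reverse_list_prod_of_isOrtho {a b : κ → M} {l : List κ}
    (h : l.Pairwise fun i j => Q.IsOrtho (b i) (a j) ∧ Q.IsOrtho (b i) (b j)) :
    ((l.map a).map (ι Q)).prod * reverse ((l.map b).map (ι Q)).prod =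
      (l.map fun k => ι Q (a k) * ι Q (b k)).prod := by
  induction l with
  | nil => simp
  | cons i l ih =>
    rw [List.pairwise_cons] at h
    have hcomm : Commute (ι Q (b i)) (l.map fun k => ι Q (a k) * ι Q (b k)).prod := by
      refine Commute.list_prod_right _ _ fun _ hY => ?_
      obtain ⟨k, hk, rfl⟩ := List.mem_map.mp hY
      obtain ⟨ha, hb⟩ := h.1 k hk
      rw [commute_iff_eq, ← mul_assoc, ι_mul_ι_comm_of_isOrtho ha, neg_mul, mul_assoc,
        ι_mul_ι_comm_of_isOrtho hb, mul_neg, neg_neg, mul_assoc]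
    simp only [List.map_cons, List.prod_cons, reverse.map_mul, reverse_ι]
    rw [mul_assoc, ← mul_assoc _ _ (ι Q (b i)), ih h.2, ← hcomm.eq, mul_assoc]

variable [Invertible (2 : R)]

lemma equivExterior_ι_mul (x : M) (X : CliffordAlgebra Q) :
    equivExterior Q (ι Q x * X) = ExteriorAlgebra.ι R x * equivExterior Q X +
      equivExterior Q (contractLeft (QuadraticMap.associated Q x) X) := by
  have hmul := changeForm_ι_mul (changeForm.associated_neg_proof (Q := Q)) x X
  have hcontract := changeForm_contractLeft (changeForm.associated_neg_proof (Q := Q))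
    (QuadraticMap.associated Q x) X
  have hneg : contractLeft (Q := (0 : QuadraticForm R M)) (QuadraticMap.associated (-Q) x) =
      -contractLeft (QuadraticMap.associated Q x) := by
    rw [map_neg, LinearMap.neg_apply, map_neg]
  rw [hneg, LinearMap.neg_apply, sub_neg_eq_add, ← hcontract] at hmul
  exact hmul

lemma equivExterior_algebraMap (c : R) :
    equivExterior Q (algebraMap R _ c) = algebraMap R _ c :=
  changeForm_algebraMap changeForm.associated_neg_proof c

lemma equivExterior_ι (x : M) : equivExterior Q (ι Q x) = ExteriorAlgebra.ι R x :=
  changeForm_ι changeForm.associated_neg_proof x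

lemma ι_injective : Function.Injective (ι Q) := fun x y h => by
  rw [← ExteriorAlgebra.ι_inj (R := R), ← equivExterior_ι (Q := Q), h, equivExterior_ι]

lemma equivExterior_list_prod {l : List M} (h : l.Pairwise Q.IsOrtho) :
    equivExterior Q (l.map (ι Q)).prod = (l.map (ExteriorAlgebra.ι R)).prod := by
  induction l with
  | nil => simp
  | cons x l ih =>
    rw [List.pairwise_cons] at h
    have hx : ∀ y ∈ l, QuadraticMap.associated Q x y = 0 := fun y hy =>
      QuadraticMap.associated_isOrtho.mpr (h.1 y hy)
    rw [List.map_cons, List.prod_cons, equivExterior_ι_mul, contractLeft_list_prod_eq_zero hx,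
      map_zero, add_zero, ih h.2, List.map_cons, List.prod_cons]

end Clifford

section Algebra

lemma pairwise_commute_algebraMap_add_smul {κ R A : Type*} [CommSemiring R] [Semiring A]
    [Algebra R A] {f : κ → A} (hf : Pairwise (Function.onFun Commute f)) (c s : κ → R) :
    Pairwise (Function.onFun Commute fun k => algebraMap R A (c k) + s k • f k) := fun _ _ hij =>
  (Algebra.commute_algebraMap_left _ _).add_left
    ((Algebra.commute_algebraMap_right _ _).add_right (((hf hij).smul_left _).smul_right _))

lemma noncommProd_algebraMap_add_smul {κ R A : Type*} [DecidableEq κ] [CommSemiring R]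
    [Semiring A] [Algebra R A] {f : κ → A} (hf : Pairwise (Function.onFun Commute f))
    (c s : κ → R) (T : Finset κ) :
    T.noncommProd (fun k => algebraMap R A (c k) + s k • f k)
        ((pairwise_commute_algebraMap_add_smul hf c s).set_pairwise _) =
      ∑ S ∈ T.powerset, ((∏ k ∈ S, s k) * ∏ k ∈ T \ S, c k) •
        S.noncommProd f (hf.set_pairwise _) := by
  induction T using Finset.induction_on with
  | empty => simp
  | insert i T hi ih =>
    rw [Finset.noncommProd_insert_of_notMem _ _ _ _ hi, ih, Finset.sum_powerset_insert hi, add_mul,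
      Finset.mul_sum, Finset.mul_sum]
    congr 1 <;> refine Finset.sum_congr rfl fun S hS => ?_
    · have hiS : i ∉ S := fun h => hi (Finset.mem_powerset.mp hS h)
      rw [Finset.insert_sdiff_of_notMem _ hiS, Finset.prod_insert (by simp [hi]),
        ← Algebra.smul_def, smul_smul, mul_left_comm]
    · have hiS : i ∉ S := fun h => hi (Finset.mem_powerset.mp hS h)
      rw [Finset.insert_sdiff_insert, Finset.sdiff_insert_of_notMem hi,
        Finset.prod_insert hiS, Finset.noncommProd_insert_of_notMem _ _ _ _ hiS, mul_smul_comm,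
        smul_mul_assoc, smul_smul, mul_assoc, mul_comm (s i)]
      congr 1
      ring

lemma alternatingMap_eq_det_smul {κ R M N : Type*} [Fintype κ] [DecidableEq κ] [CommRing R]
    [AddCommGroup M] [Module R M] [AddCommGroup N] [Module R N] (e : Module.Basis κ R M)
    (f : M [⋀^κ]→ₗ[R] N) (v : κ → M) : f v = e.det v • f e := by
  have hf : f = (LinearMap.toSpanSingleton R N (f e)).compAlternatingMap e.det := by
    refine Module.Basis.ext_alternating e fun w hw => ?_
    let σ : Equiv.Perm κ := Equiv.ofBijective w (Finite.injective_iff_bijective.mp hw)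
    have hfσ : f (fun i => e (w i)) = Equiv.Perm.sign σ • f e := f.map_perm e σ
    have hdet : e.det (fun i => e (w i)) = Equiv.Perm.sign σ • e.det e := e.det.map_perm e σ
    rw [LinearMap.compAlternatingMap_apply, LinearMap.toSpanSingleton_apply, hfσ, hdet,
      e.det_self, Units.smul_def, Units.smul_def, zsmul_eq_mul, mul_one, Int.cast_smul_eq_zsmul]
  conv_lhs => rw [hf]
  rfl

end Algebra

section InnerProduct

variable {𝕜 E F κ κ' : Type*} [RCLike 𝕜] [NormedAddCommGroup E] [InnerProductSpace 𝕜 E]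
  [NormedAddCommGroup F] [InnerProductSpace 𝕜 F]

lemma orthonormal_sumElim {e : κ → E} {f : κ' → E} (he : Orthonormal 𝕜 e) (hf : Orthonormal 𝕜 f)
    (h : ∀ i j, inner 𝕜 (e i) (f j) = 0) : Orthonormal 𝕜 (Sum.elim e f) := by
  refine ⟨?_, ?_⟩
  · rintro (i | j)
    exacts [he.1 i, hf.1 j]
  · rintro (i | i) (j | j) hij
    exacts [he.2 fun h => hij (h ▸ rfl), h i j, inner_eq_zero_symm.mp (h j i),
      hf.2 fun h => hij (h ▸ rfl)]

lemma fin_append_eq_sumElim_comp {α : Type*} {r q : ℕ} (e : Fin r → α) (f : Fin q → α) :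
    Fin.append e f = Sum.elim e f ∘ finSumFinEquiv.symm := by
  rw [← Fin.append_comp_sumElim, Function.comp_assoc]
  ext1 i
  refine congrArg (Fin.append e f) ?_
  exact (finSumFinEquiv.apply_symm_apply i).symm

lemma range_fin_append {α : Type*} {r q : ℕ} (e : Fin r → α) (f : Fin q → α) :
    Set.range (Fin.append e f) = Set.range e ∪ Set.range f := by
  rw [fin_append_eq_sumElim_comp, finSumFinEquiv.symm.surjective.range_comp, Set.Sum.elim_range]

lemma orthonormal_fin_append {r q : ℕ} {e : Fin r → E} {f : Fin q → E} (he : Orthonormal 𝕜 e)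
    (hf : Orthonormal 𝕜 f) (h : ∀ i j, inner 𝕜 (e i) (f j) = 0) :
    Orthonormal 𝕜 (Fin.append e f) := by
  rw [fin_append_eq_sumElim_comp]
  exact (orthonormal_sumElim he hf h).comp _ finSumFinEquiv.symm.injective

lemma orthonormal_update_neg [DecidableEq κ] {e : κ → E} (he : Orthonormal 𝕜 e) (i : κ) :
    Orthonormal 𝕜 (Function.update e i (-e i)) :=
  he.orthonormal_of_forall_eq_or_eq_neg fun j => by
    rcases eq_or_ne j i with rfl | hj
    · exact Or.inr (Function.update_self ..)
    · exact Or.inl (Function.update_of_ne hj ..)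

lemma span_range_update_neg {R M : Type*} [Ring R] [AddCommGroup M] [Module R M] [DecidableEq κ]
    (e : κ → M) (i : κ) :
    Submodule.span R (Set.range (Function.update e i (-e i))) =
      Submodule.span R (Set.range e) := by
  have hle : ∀ f : κ → M, Submodule.span R (Set.range (Function.update f i (-f i))) ≤
      Submodule.span R (Set.range f) := by
    refine fun f => Submodule.span_le.mpr ?_
    rintro _ ⟨j, rfl⟩
    have hj : f j ∈ Submodule.span R (Set.range f) := Submodule.subset_span ⟨j, rfl⟩
    rcases eq_or_ne j i with rfl | hji
    · simpa using hj
    · simpa [hji] using hj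
  exact le_antisymm (hle e) (by simpa using hle (Function.update e i (-e i)))

lemma span_range_coe_orthonormalBasis [Fintype κ] {K : Submodule 𝕜 E}
    (e : OrthonormalBasis κ 𝕜 K) : Submodule.span 𝕜 (Set.range fun i => (e i : E)) = K := by
  have he : Submodule.span 𝕜 (Set.range e) = ⊤ := by simpa using e.toBasis.span_eq
  have hrange : (Set.range fun i => (e i : E)) = K.subtype '' Set.range e := by
    rw [← Set.range_comp]
    rfl
  rw [hrange, Submodule.span_image, he, Submodule.map_subtype_top]

lemma exists_orthonormalBasis_apply_eq_norm_smul [FiniteDimensional 𝕜 E] [FiniteDimensional 𝕜 F]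
    {r : ℕ} (hE : Module.finrank 𝕜 E = r) (hF : Module.finrank 𝕜 F = r) (T : E →ₗ[𝕜] F) :
    ∃ (a : OrthonormalBasis (Fin r) 𝕜 E) (b : OrthonormalBasis (Fin r) 𝕜 F),
      ∀ k, T (a k) = (‖T (a k)‖ : 𝕜) • b k := by
  have hS := (LinearMap.isPositive_adjoint_comp_self T).isSymmetric
  let a := hS.eigenvectorBasis hE
  have hTa : ∀ k l, k ≠ l → inner 𝕜 (T (a k)) (T (a l)) = 0 := fun k l hkl => by
    have hk : LinearMap.adjoint T (T (a k)) = (hS.eigenvalues hE k : 𝕜) • a k :=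
      hS.apply_eigenvectorBasis hE k
    rw [← LinearMap.adjoint_inner_left, hk, inner_smul_left, a.orthonormal.2 hkl, mul_zero]
  let w : Fin r → F := fun k => (‖T (a k)‖⁻¹ : 𝕜) • T (a k)
  let s : Set (Fin r) := {k | T (a k) ≠ 0}
  have hw : Orthonormal 𝕜 (s.domRestrict w) := by
    refine ⟨fun k => norm_smul_inv_norm k.2, fun k l hkl => ?_⟩
    change inner 𝕜 (w k) (w l) = 0
    rw [inner_smul_left, inner_smul_right, hTa k l fun h => hkl (Subtype.ext h), mul_zero, mul_zero]
  obtain ⟨b, hb⟩ := hw.exists_orthonormalBasis_extension_of_card_eq (by simpa using hF)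
  refine ⟨a, b, fun k => ?_⟩
  by_cases hk : T (a k) = 0
  · simp [hk]
  · rw [hb k hk, smul_inv_smul₀ (by simpa using hk)]

open InnerProductSpace Module.End in
lemma eigenspace_sum_smul_rankOne [Fintype κ] {g : κ → E} (hg : Orthonormal 𝕜 g) (μ : κ → 𝕜) {c : 𝕜}
    (hc : c ≠ 0) :
    eigenspace (∑ i, μ i • rankOne 𝕜 (g i) (g i)).toLinearMap c =
      Submodule.span 𝕜 (Set.range fun i : {i // μ i = c} => g i) := by
  classical
  have happly : ∀ x, (∑ i, μ i • rankOne 𝕜 (g i) (g i)) x =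
      ∑ i, (μ i * inner 𝕜 (g i) x) • g i := fun x => by
    simp [smul_smul]
  refine le_antisymm (fun x hx => ?_) (Submodule.span_le.mpr ?_)
  · rw [mem_eigenspace_iff, ContinuousLinearMap.coe_coe, happly] at hx
    have hcoeff : ∀ i, μ i ≠ c → inner 𝕜 (g i) x = 0 := fun i hi => by
      have hi' := congrArg (inner 𝕜 (g i)) hx
      rw [hg.inner_right_fintype, inner_smul_right, ← sub_eq_zero, ← sub_mul] at hi'
      exact (mul_eq_zero.mp hi').resolve_left (sub_ne_zero.mpr hi)
    rw [← inv_smul_smul₀ hc x, ← hx]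
    refine Submodule.smul_mem _ _ (Submodule.sum_mem _ fun i _ => ?_)
    by_cases hi : μ i = c
    · exact Submodule.smul_mem _ _ (Submodule.subset_span ⟨⟨i, hi⟩, rfl⟩)
    · rw [hcoeff i hi, mul_zero, zero_smul]
      exact Submodule.zero_mem _
  · rintro _ ⟨⟨i, rfl⟩, rfl⟩
    rw [SetLike.mem_coe, mem_eigenspace_iff, ContinuousLinearMap.coe_coe, happly]
    simp [orthonormal_iff_ite.mp hg]

end InnerProduct

section BivectorEnd

open InnerProductSpace Module.End

variable {E κ κ' : Type*} [NormedAddCommGroup E] [InnerProductSpace ℝ E] [Fintype κ] [Fintype κ']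

/-- The skew endomorphism `x ↦ x ⌋ F` of a bivector `F = ∑ⱼ τⱼ (uⱼ ∧ vⱼ)`. -/
def bivectorEnd (τ : κ → ℝ) (u v : κ → E) : E →L[ℝ] E :=
  ∑ j, τ j • (rankOne ℝ (v j) (u j) - rankOne ℝ (u j) (v j))

lemma bivectorEnd_apply (τ : κ → ℝ) (u v : κ → E) (x : E) :
    bivectorEnd τ u v x = ∑ j, τ j • (⟪x, u j⟫ • v j - ⟪x, v j⟫ • u j) := by
  simp [bivectorEnd, real_inner_comm]

lemma bivectorEnd_apply_left {u v : κ → E} (h : Orthonormal ℝ (Sum.elim u v))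
    (τ : κ → ℝ) (i : κ) : bivectorEnd τ u v (u i) = τ i • v i := by
  classical
  have huu : ∀ j, ⟪u i, u j⟫ = if i = j then 1 else 0 := fun j => by
    simpa using orthonormal_iff_ite.mp h (Sum.inl i) (Sum.inl j)
  have huv : ∀ j, ⟪u i, v j⟫ = 0 := fun j => h.2 (i := Sum.inl i) (j := Sum.inr j) (by simp)
  simp [bivectorEnd_apply, huu, huv]

lemma bivectorEnd_apply_right {u v : κ → E} (h : Orthonormal ℝ (Sum.elim u v))
    (τ : κ → ℝ) (i : κ) : bivectorEnd τ u v (v i) = -(τ i • u i) := by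
  classical
  have hvv : ∀ j, ⟪v i, v j⟫ = if i = j then 1 else 0 := fun j => by
    simpa using orthonormal_iff_ite.mp h (Sum.inr i) (Sum.inr j)
  have hvu : ∀ j, ⟪v i, u j⟫ = 0 := fun j => h.2 (i := Sum.inr i) (j := Sum.inl j) (by simp)
  simp [bivectorEnd_apply, hvv, hvu]

lemma neg_bivectorEnd_mul_self {u v : κ → E} (h : Orthonormal ℝ (Sum.elim u v)) (τ : κ → ℝ) :
    -(bivectorEnd τ u v * bivectorEnd τ u v) =
      ∑ i, Sum.elim τ τ i ^ 2 • rankOne ℝ (Sum.elim u v i) (Sum.elim u v i) := by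
  ext1 x
  rw [neg_apply, mul_apply_eq_comp, bivectorEnd_apply τ u v x]
  simp only [map_sum, map_smul, map_sub, bivectorEnd_apply_left h, bivectorEnd_apply_right h,
    Fintype.sum_sum_type, Sum.elim_inl, Sum.elim_inr, add_apply, sum_apply, smul_apply,
    rankOne_apply, real_inner_comm x, ← Finset.sum_add_distrib, ← Finset.sum_neg_distrib]
  refine Finset.sum_congr rfl fun j _ => ?_
  module

lemma finrank_eigenspace_neg_bivectorEnd_mul_self {u v : κ → E}
    (h : Orthonormal ℝ (Sum.elim u v)) {τ : κ → ℝ} (hτ : ∀ j, 0 < τ j) {c : ℝ} (hc : 0 < c) :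
    Module.finrank ℝ (eigenspace (-(bivectorEnd τ u v * bivectorEnd τ u v)).toLinearMap (c ^ 2)) =
      2 * ((Finset.univ : Finset κ).val.map τ).count c := by
  classical
  have hsq : ∀ j, τ j ^ 2 = c ^ 2 ↔ c = τ j := fun j => by
    rw [pow_left_inj₀ (hτ j).le hc.le two_ne_zero, eq_comm]
  have hli := (h.comp _ (Subtype.val_injective
    (p := fun i => Sum.elim τ τ i ^ 2 = c ^ 2))).linearIndependent
  rw [neg_bivectorEnd_mul_self h, eigenspace_sum_smul_rankOne h _ (pow_ne_zero 2 hc.ne')]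
  refine (finrank_span_eq_card hli).trans ?_
  rw [Fintype.card_congr Equiv.subtypeSum, Fintype.card_sum, Multiset.count_map, two_mul]
  simp only [Sum.elim_inl, Sum.elim_inr, hsq, Fintype.card_subtype]
  rfl

lemma multiset_map_eq_of_bivectorEnd_eq {u v : κ → E} {u' v' : κ' → E} {τ : κ → ℝ} {τ' : κ' → ℝ}
    (h : Orthonormal ℝ (Sum.elim u v)) (h' : Orthonormal ℝ (Sum.elim u' v'))
    (hτ : ∀ j, 0 < τ j) (hτ' : ∀ j, 0 < τ' j)
    (heq : bivectorEnd τ u v = bivectorEnd τ' u' v') :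
    (Finset.univ : Finset κ).val.map τ = (Finset.univ : Finset κ').val.map τ' := by
  ext c
  by_cases hc : 0 < c
  · have hcount := finrank_eigenspace_neg_bivectorEnd_mul_self h hτ hc
    rw [heq, finrank_eigenspace_neg_bivectorEnd_mul_self h' hτ' hc] at hcount
    exact (mul_left_cancel₀ two_ne_zero hcount).symm
  · rw [Multiset.count_eq_zero_of_notMem, Multiset.count_eq_zero_of_notMem]
    · simpa using fun j (hj : τ' j = c) => hc (hj ▸ hτ' j)
    · simpa using fun j (hj : τ j = c) => hc (hj ▸ hτ j)

end BivectorEnd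

section Blades

open CliffordAlgebra

variable {n q r : ℕ} {X Y : Cl n} {x y : V n}

lemma isOrtho_Q_iff : (Q n).IsOrtho x y ↔ ⟪x, y⟫ = 0 := by
  rw [← QuadraticMap.associated_isOrtho, QuadraticMap.associated_left_inverse ℝ
    (fun x y => real_inner_comm y x), innerₗ_apply_apply]

lemma Q_apply_eq_one_of_norm_eq_one (h : ‖x‖ = 1) : Q n x = 1 := by
  rw [LinearMap.BilinMap.toQuadraticMap_apply, innerₗ_apply_apply, real_inner_self_eq_norm_sq, h,
    one_pow]

lemma toGrassmann_ι_mul (x : V n) (X : Cl n) :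
    toGrassmann n (ι (Q n) x * X) =
      ExteriorAlgebra.ι ℝ x * toGrassmann n X + toGrassmann n (contract x X) := by
  rw [toGrassmann, equivExterior_ι_mul, contract, QuadraticMap.associated_left_inverse ℝ
    (fun x y => real_inner_comm y x)]

lemma contract_ι_mul (x y : V n) (X : Cl n) :
    contract x (ι (Q n) y * X) = ⟪x, y⟫ • X - ι (Q n) y * contract x X := by
  rw [contract, contractLeft_ι_mul, innerₗ_apply_apply, contract]

lemma mem_bladeSpace_iff : x ∈ bladeSpace X ↔ contract x X = ι (Q n) x * X := by
  rw [← (toGrassmann n).injective.eq_iff, toGrassmann_ι_mul, eq_comm, add_eq_right]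
  rfl

lemma inner_eq_zero_of_contract_eq_zero (hY : Y ≠ 0) (hx : contract x Y = 0)
    (hy : y ∈ bladeSpace Y) : ⟪x, y⟫ = 0 := by
  have hcomm : contract x (contract y Y) = -contract y (contract x Y) :=
    contractLeft_comm _ _ Y
  rw [mem_bladeSpace_iff.mp hy, contract_ι_mul, hx, mul_zero, sub_zero] at hcomm
  simpa [contract, hY] using hcomm

lemma BladeOrthogonal.isOrtho_bladeSpace (h : BladeOrthogonal X Y) (hY : Y ≠ 0) :
    bladeSpace X ⟂ bladeSpace Y :=
  Submodule.isOrtho_iff_inner_eq.mpr fun x hx _ hy =>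
    inner_eq_zero_of_contract_eq_zero hY (h x (mem_bladeSpace_iff.mp hx)) hy

lemma outer_eq_list_prod {v : Fin r → V n} (h : Pairwise fun i j => ⟪v i, v j⟫ = 0) :
    outer v = ((List.ofFn v).map (ι (Q n))).prod := by
  have hv : (List.ofFn v).Pairwise (Q n).IsOrtho :=
    List.pairwise_ofFn.mpr fun i j hij => isOrtho_Q_iff.mpr (h hij.ne)
  rw [outer, LinearEquiv.symm_apply_eq, toGrassmann, equivExterior_list_prod hv,
    ExteriorAlgebra.ιMulti_apply, List.map_ofFn]
  rfl

lemma outer_pair (x y : V n) :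
    outer ![x, y] = ι (Q n) x * ι (Q n) y - algebraMap ℝ _ ⟪x, y⟫ := by
  have hcontract : contract x (ι (Q n) y) = algebraMap ℝ _ ⟪x, y⟫ := contractLeft_ι _ _ y
  rw [outer, LinearEquiv.symm_apply_eq, map_sub, toGrassmann_ι_mul, hcontract, add_sub_cancel_right,
    toGrassmann, equivExterior_ι, ExteriorAlgebra.ιMulti_apply]
  simp

lemma outer_eq_zero {v : Fin r → V n} (h : ¬LinearIndependent ℝ v) : outer v = 0 := by
  rw [outer, AlternatingMap.map_linearDependent _ v h, map_zero]

lemma mem_bladeSpace_outer (v : Fin r → V n) (i : Fin r) : v i ∈ bladeSpace (outer v) := by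
  change ExteriorAlgebra.ι ℝ (v i) * toGrassmann n (outer v) = 0
  have hcons := ExteriorAlgebra.ιMulti_succ_apply (R := ℝ) (Fin.cons (v i) v : Fin (r + 1) → V n)
  rw [Fin.cons_zero] at hcons
  rw [outer, LinearEquiv.apply_symm_apply]
  exact hcons.symm.trans <| (ExteriorAlgebra.ιMulti ℝ (r + 1)).map_eq_zero_of_eq _
    (by rw [Fin.cons_zero, Fin.cons_succ]) (Fin.succ_ne_zero i).symm

lemma exists_outer_eq_smul {v e : Fin r → V n} (he : LinearIndependent ℝ e)
    (h : ∀ i, v i ∈ Submodule.span ℝ (Set.range e)) : ∃ c : ℝ, outer v = c • outer e := by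
  let b := Module.Basis.span he
  let f := (ExteriorAlgebra.ιMulti ℝ r).compLinearMap (Submodule.span ℝ (Set.range e)).subtype
  have hb : f b = ExteriorAlgebra.ιMulti ℝ r e := congrArg (ExteriorAlgebra.ιMulti ℝ r)
    (funext fun i => congrArg Subtype.val (Module.Basis.span_apply he i))
  refine ⟨b.det fun i => ⟨v i, h i⟩, ?_⟩
  rw [outer, outer, ← map_smul, ← hb, ← alternatingMap_eq_det_smul b f]
  rfl

lemma gradePart_smul (j : ℕ) (c : ℝ) (X : Cl n) : gradePart j (c • X) = c • gradePart j X := by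
  simp [gradePart]

lemma gradePart_sum {κ : Type*} (j : ℕ) (s : Finset κ) (f : κ → Cl n) :
    gradePart j (∑ i ∈ s, f i) = ∑ i ∈ s, gradePart j (f i) := by
  simp [gradePart]

lemma gradePart_outer (v : Fin r → V n) (j : ℕ) :
    gradePart j (outer v) = if r = j then outer v else 0 := by
  have hmem : ExteriorAlgebra.ιMulti ℝ r v ∈ ⋀[ℝ]^r (V n) :=
    ExteriorAlgebra.ιMulti_range ℝ r ⟨v, rfl⟩
  rw [gradePart, GradedAlgebra.proj_apply, LinearEquiv.symm_apply_eq, outer,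
    LinearEquiv.apply_symm_apply]
  split_ifs with hrj
  · subst hrj
    rw [DirectSum.decompose_of_mem_same (fun i : ℕ => ⋀[ℝ]^i (V n)) hmem,
      LinearEquiv.apply_symm_apply]
  · rw [DirectSum.decompose_of_mem_ne (fun i : ℕ => ⋀[ℝ]^i (V n)) hmem hrj, map_zero]

lemma scalarPart_smul (c : ℝ) (X : Cl n) : scalarPart (c • X) = c * scalarPart X := by
  simp [scalarPart]

lemma scalarPart_sum {κ : Type*} (s : Finset κ) (f : κ → Cl n) :
    scalarPart (∑ i ∈ s, f i) = ∑ i ∈ s, scalarPart (f i) := by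
  simp [scalarPart]

lemma scalarPart_one : scalarPart (1 : Cl n) = 1 := by
  rw [scalarPart, toGrassmann, ← map_one (algebraMap ℝ (Cl n)), equivExterior_algebraMap, map_one,
    map_one]

lemma scalarPart_outer (hr : r ≠ 0) (v : Fin r → V n) : scalarPart (outer v) = 0 := by
  obtain ⟨k, rfl⟩ := Nat.exists_eq_succ_of_ne_zero hr
  have hι : ExteriorAlgebra.algebraMapInv (ExteriorAlgebra.ι ℝ (v 0)) = 0 := by
    simp [ExteriorAlgebra.algebraMapInv]
  rw [scalarPart, outer, LinearEquiv.apply_symm_apply, ExteriorAlgebra.ιMulti_succ_apply, map_mul,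
    hι, zero_mul]

lemma magnitude_smul (c : ℝ) (X : Cl n) : magnitude (c • X) = |c| * magnitude X := by
  rw [magnitude, map_smul, smul_mul_smul_comm, scalarPart_smul,
    Real.sqrt_mul (mul_self_nonneg c), Real.sqrt_mul_self_eq_abs, magnitude]

section Orthonormal

variable {e : Fin r → V n} (he : Orthonormal ℝ e)

include he

lemma outer_eq_list_prod_of_orthonormal : outer e = ((List.ofFn e).map (ι (Q n))).prod :=
  outer_eq_list_prod fun _ _ hij => he.2 hij

lemma Q_apply_eq_one_of_mem_ofFn : ∀ x ∈ List.ofFn e, Q n x = 1 :=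
  (List.forall_mem_ofFn_iff (P := fun x => Q n x = 1)).mpr
    fun i => Q_apply_eq_one_of_norm_eq_one (he.1 i)

lemma outer_mul_reverse : outer e * reverse (outer e) = 1 := by
  rw [outer_eq_list_prod_of_orthonormal he, list_prod_mul_reverse (Q_apply_eq_one_of_mem_ofFn he)]

lemma reverse_mul_outer : reverse (outer e) * outer e = 1 := by
  rw [outer_eq_list_prod_of_orthonormal he, reverse_mul_list_prod (Q_apply_eq_one_of_mem_ofFn he)]

lemma isUnit_outer : IsUnit (outer e) := ⟨⟨_, _, outer_mul_reverse he, reverse_mul_outer he⟩, rfl⟩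

lemma isNormedBlade_outer : IsNormedBlade r (outer e) :=
  ⟨⟨e, rfl⟩, by rw [magnitude, outer_mul_reverse he, scalarPart_one, Real.sqrt_one]⟩

lemma bladeSpace_outer : bladeSpace (outer e) = Submodule.span ℝ (Set.range e) := by
  set U := Submodule.span ℝ (Set.range e)
  have hle : U ≤ bladeSpace (outer e) := Submodule.span_le.mpr <| by
    rintro _ ⟨i, rfl⟩
    exact mem_bladeSpace_outer e i
  refine le_antisymm (fun x hx => ?_) hle
  have horth : x - U.starProjection x ∈ Uᗮ := Submodule.sub_starProjection_mem_orthogonal x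
  have hcontract : contract (x - U.starProjection x) (outer e) = 0 := by
    rw [outer_eq_list_prod_of_orthonormal he]
    refine contractLeft_list_prod_eq_zero (List.forall_mem_ofFn_iff.mpr fun i => ?_)
    exact (Submodule.mem_orthogonal' _ _).mp horth _ (Submodule.subset_span ⟨i, rfl⟩)
  have hmem : x - U.starProjection x ∈ bladeSpace (outer e) :=
    sub_mem hx (hle (U.starProjection_apply_mem x))
  have hself := inner_eq_zero_of_contract_eq_zero (isUnit_outer he).ne_zero hcontract hmem
  rw [inner_self_eq_zero, sub_eq_zero] at hself
  exact hself ▸ U.starProjection_apply_mem x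

lemma outer_mul_outer {f : Fin q → V n} (hf : Orthonormal ℝ f) (hef : ∀ i j, ⟪e i, f j⟫ = 0) :
    outer e * outer f = outer (Fin.append e f) := by
  rw [outer_eq_list_prod_of_orthonormal he, outer_eq_list_prod_of_orthonormal hf,
    outer_eq_list_prod_of_orthonormal (orthonormal_fin_append he hf hef), List.ofFn_fin_append,
    List.map_append, List.prod_append]

end Orthonormal

lemma isNormedBlade_iff : IsNormedBlade r X ↔ ∃ e : Fin r → V n, Orthonormal ℝ e ∧ X = outer e := by
  refine ⟨?_, fun ⟨e, he, hX⟩ => hX ▸ isNormedBlade_outer he⟩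
  rintro ⟨⟨v, rfl⟩, hv⟩
  have hli : LinearIndependent ℝ v := by
    by_contra hli
    simp [outer_eq_zero hli, magnitude, scalarPart] at hv
  let b := (stdOrthonormalBasis ℝ (Submodule.span ℝ (Set.range v))).reindex
    (finCongr (by simpa using finrank_span_eq_card hli))
  let e : Fin r → V n := fun i => b i
  have he : Orthonormal ℝ e := b.orthonormal.comp_linearIsometry (Submodule.subtypeₗᵢ _)
  obtain ⟨c, hc⟩ := exists_outer_eq_smul (v := v) he.linearIndependent fun i => by
    rw [span_range_coe_orthonormalBasis b]
    exact Submodule.subset_span ⟨i, rfl⟩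
  rw [hc, magnitude_smul, (isNormedBlade_outer he).2, mul_one] at hv
  rcases eq_or_eq_neg_of_abs_eq hv with rfl | rfl
  · exact ⟨e, he, by rw [hc, one_smul]⟩
  · -- The sign is absorbed by reversing one vector.
    rcases r with _ | r
    · exact ⟨e, he, congrArg outer (Subsingleton.elim v e)⟩
    · refine ⟨_, orthonormal_update_neg he 0, ?_⟩
      rw [hc, neg_one_smul, outer, outer, AlternatingMap.map_update_neg, Function.update_eq_self,
        map_neg]

namespace IsNormedBlade

lemma gradePart_eq (hX : IsNormedBlade r X) (j : ℕ) :
    gradePart j X = if r = j then X else 0 := by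
  obtain ⟨⟨v, rfl⟩, -⟩ := hX
  exact gradePart_outer v j

lemma scalarPart_eq_zero (hX : IsNormedBlade r X) (hr : r ≠ 0) : scalarPart X = 0 := by
  obtain ⟨⟨v, rfl⟩, -⟩ := hX
  exact scalarPart_outer hr v

lemma isUnit (hX : IsNormedBlade r X) : IsUnit X := by
  obtain ⟨e, he, rfl⟩ := isNormedBlade_iff.mp hX
  exact isUnit_outer he

lemma ne_zero (hX : IsNormedBlade r X) : X ≠ 0 := hX.isUnit.ne_zero

lemma finrank_bladeSpace (hX : IsNormedBlade r X) : Module.finrank ℝ (bladeSpace X) = r := by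
  obtain ⟨e, he, rfl⟩ := isNormedBlade_iff.mp hX
  rw [bladeSpace_outer he]
  simpa using finrank_span_eq_card he.linearIndependent

lemma eq_or_eq_neg (hX : IsNormedBlade r X) (hY : IsNormedBlade r Y)
    (h : bladeSpace X = bladeSpace Y) : X = Y ∨ X = -Y := by
  obtain ⟨e, he, rfl⟩ := isNormedBlade_iff.mp hX
  obtain ⟨f, hf, rfl⟩ := isNormedBlade_iff.mp hY
  rw [bladeSpace_outer he, bladeSpace_outer hf] at h
  obtain ⟨c, hc⟩ := exists_outer_eq_smul (v := e) hf.linearIndependent fun i =>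
    h ▸ Submodule.subset_span ⟨i, rfl⟩
  have hnorm := hX.2
  rw [hc, magnitude_smul, hY.2, mul_one] at hnorm
  rcases eq_or_eq_neg_of_abs_eq hnorm with rfl | rfl
  · exact Or.inl (by rw [hc, one_smul])
  · exact Or.inr (by rw [hc, neg_one_smul])

lemma exists_outer_of_isOrtho (hX : IsNormedBlade r X) (hY : IsNormedBlade q Y)
    (h : bladeSpace X ⟂ bladeSpace Y) : ∃ (e : Fin r → V n) (f : Fin q → V n),
      Orthonormal ℝ e ∧ Orthonormal ℝ f ∧ (∀ i j, ⟪e i, f j⟫ = 0) ∧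
        X = outer e ∧ Y = outer f := by
  obtain ⟨e, he, rfl⟩ := isNormedBlade_iff.mp hX
  obtain ⟨f, hf, rfl⟩ := isNormedBlade_iff.mp hY
  rw [bladeSpace_outer he, bladeSpace_outer hf] at h
  exact ⟨e, f, he, hf, fun i j => Submodule.isOrtho_iff_inner_eq.mp h _
    (Submodule.subset_span ⟨i, rfl⟩) _ (Submodule.subset_span ⟨j, rfl⟩), rfl, rfl⟩

lemma mul_eq_neg_one_pow_smul_mul (hX : IsNormedBlade r X) (hY : IsNormedBlade q Y)
    (h : bladeSpace X ⟂ bladeSpace Y) : X * Y = (-1 : ℝ) ^ (r * q) • (Y * X) := by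
  obtain ⟨e, f, he, hf, hef, rfl, rfl⟩ := hX.exists_outer_of_isOrtho hY h
  have hortho : ∀ x ∈ List.ofFn e, ∀ y ∈ List.ofFn f, (Q n).IsOrtho x y := by
    simpa only [List.forall_mem_ofFn_iff, isOrtho_Q_iff] using hef
  simpa only [outer_eq_list_prod_of_orthonormal he, outer_eq_list_prod_of_orthonormal hf,
    List.length_ofFn] using list_prod_mul_list_prod_of_isOrtho hortho

lemma commute_of_even (hX : IsNormedBlade r X) (hY : IsNormedBlade q Y)
    (h : bladeSpace X ⟂ bladeSpace Y) (hr : Even r) : Commute X Y := by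
  rw [commute_iff_eq, hX.mul_eq_neg_one_pow_smul_mul hY h, (hr.mul_right q).neg_one_pow, one_smul]

lemma mul (hX : IsNormedBlade r X) (hY : IsNormedBlade q Y) (h : bladeSpace X ⟂ bladeSpace Y) :
    IsNormedBlade (r + q) (X * Y) := by
  obtain ⟨e, f, he, hf, hef, rfl, rfl⟩ := hX.exists_outer_of_isOrtho hY h
  exact outer_mul_outer he hf hef ▸ isNormedBlade_outer (orthonormal_fin_append he hf hef)

lemma bladeSpace_mul (hX : IsNormedBlade r X) (hY : IsNormedBlade q Y)
    (h : bladeSpace X ⟂ bladeSpace Y) : bladeSpace (X * Y) = bladeSpace X ⊔ bladeSpace Y := by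
  obtain ⟨e, f, he, hf, hef, rfl, rfl⟩ := hX.exists_outer_of_isOrtho hY h
  rw [outer_mul_outer he hf hef, bladeSpace_outer (orthonormal_fin_append he hf hef),
    bladeSpace_outer he, bladeSpace_outer hf, range_fin_append, Submodule.span_union]

end IsNormedBlade

end Blades

section PrincipalSystem

open CliffordAlgebra

variable {n r : ℕ} {U W : Submodule ℝ (V n)} {a b : Fin r → V n} {k l : Fin r}
  {S T : Finset (Fin r)}

lemma exists_isPrincipalSystem (hU : Module.finrank ℝ U = r) (hW : Module.finrank ℝ W = r) :
    ∃ a b : Fin r → V n, IsPrincipalSystem U W a b := by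
  let P : U →ₗ[ℝ] W := W.orthogonalProjectionOnto.toLinearMap ∘ₗ U.subtype
  obtain ⟨a, b, hab⟩ := exists_orthonormalBasis_apply_eq_norm_smul hU hW P
  have hinner : ∀ k l, ⟪(a k : V n), (b l : V n)⟫ = ‖P (a k)‖ * ⟪b k, b l⟫ := fun k l => by
    have hP : ⟪(a k : V n), (b l : V n)⟫ = ⟪P (a k), b l⟫ :=
      (Submodule.inner_orthogonalProjectionOnto_eq_of_mem_right (b l) (a k : V n)).symm
    rw [hP]
    nth_rewrite 1 [hab k]
    exact real_inner_smul_left _ _ _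
  refine ⟨fun k => a k, fun k => b k, a.orthonormal.comp_linearIsometry U.subtypeₗᵢ,
    b.orthonormal.comp_linearIsometry W.subtypeₗᵢ, span_range_coe_orthonormalBasis a,
    span_range_coe_orthonormalBasis b, fun k l hkl => ?_, fun k => ?_⟩
  · rw [hinner, b.orthonormal.2 hkl, mul_zero]
  · rw [hinner]
    exact mul_nonneg (norm_nonneg _) real_inner_self_nonneg

lemma mem_parIdx : k ∈ parIdx a b ↔ ang a b k = 0 := by simp [parIdx]

lemma mem_midIdx : k ∈ midIdx a b ↔ 0 < ang a b k ∧ ang a b k < Real.pi / 2 := by simp [midIdx]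

lemma mem_perpIdx : k ∈ perpIdx a b ↔ ang a b k = Real.pi / 2 := by simp [perpIdx]

lemma ang_nonneg : 0 ≤ ang a b k := InnerProductGeometry.angle_nonneg _ _

lemma ang_ne_zero_of_mem_midIdx (hk : k ∈ midIdx a b) : ang a b k ≠ 0 := (mem_midIdx.mp hk).1.ne'

lemma ang_ne_zero_of_mem_perpIdx (hk : k ∈ perpIdx a b) : ang a b k ≠ 0 :=
  mem_perpIdx.mp hk ▸ Real.pi_div_two_pos.ne'

lemma disjoint_parIdx_midIdx : Disjoint (parIdx a b) (midIdx a b) :=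
  Finset.disjoint_left.mpr fun _ hk hk' => ang_ne_zero_of_mem_midIdx hk' (mem_parIdx.mp hk)

lemma disjoint_midIdx_perpIdx : Disjoint (midIdx a b) (perpIdx a b) :=
  Finset.disjoint_left.mpr fun _ hk hk' => (mem_midIdx.mp hk).2.ne (mem_perpIdx.mp hk')

lemma disjoint_parIdx_union_midIdx_perpIdx :
    Disjoint (parIdx a b ∪ midIdx a b) (perpIdx a b) :=
  Finset.disjoint_union_left.mpr ⟨Finset.disjoint_left.mpr fun _ hk hk' =>
    ang_ne_zero_of_mem_perpIdx hk' (mem_parIdx.mp hk), disjoint_midIdx_perpIdx⟩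

lemma cos_ang_pos (hk : k ∈ midIdx a b) : 0 < Real.cos (ang a b k) :=
  Real.cos_pos_of_mem_Ioo ⟨(neg_lt_zero.mpr Real.pi_div_two_pos).trans (mem_midIdx.mp hk).1,
    (mem_midIdx.mp hk).2⟩

lemma tan_ang_pos (hk : k ∈ midIdx a b) : 0 < Real.tan (ang a b k) :=
  Real.tan_pos_of_pos_of_lt_pi_div_two (mem_midIdx.mp hk).1 (mem_midIdx.mp hk).2

lemma prod_cos_ang_pos : 0 < ∏ k ∈ midIdx a b, Real.cos (ang a b k) :=
  Finset.prod_pos fun _ => cos_ang_pos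

lemma prod_tan_ang_pos : 0 < ∏ k ∈ midIdx a b, Real.tan (ang a b k) :=
  Finset.prod_pos fun _ => tan_ang_pos

/-- The span of the principal vectors `aₖ` and `bₖ`, a plane or a line according to whether
`θₖ ≠ 0`. -/
def principalPlane (a b : Fin r → V n) (k : Fin r) : Submodule ℝ (V n) :=
  Submodule.span ℝ {a k, b k}

lemma left_mem_principalPlane : a k ∈ principalPlane a b k := Submodule.subset_span (by simp)

lemma right_mem_principalPlane : b k ∈ principalPlane a b k := Submodule.subset_span (by simp)

/-- The unit vector completing `aₖ` to an orthonormal basis of the `k`-th principal plane; it is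
used only for `θₖ ≠ 0`. -/
def planeNormal (a b : Fin r → V n) (k : Fin r) : V n :=
  (Real.sin (ang a b k))⁻¹ • (b k - Real.cos (ang a b k) • a k)

lemma planeNormal_mem_principalPlane : planeNormal a b k ∈ principalPlane a b k :=
  Submodule.smul_mem _ _
    (sub_mem right_mem_principalPlane (Submodule.smul_mem _ _ left_mem_principalPlane))

/-- The rotor `cos θₖ + sin θₖ 𝐢ₖ` of the `k`-th principal plane; it is the geometric product
`aₖ bₖ`. -/
def planeRotor (a b : Fin r → V n) (k : Fin r) : Cl n :=
  algebraMap ℝ _ (Real.cos (ang a b k)) + Real.sin (ang a b k) • planeBivector a b k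

lemma planeBivector_eq_zero (hk : ang a b k = 0) : planeBivector a b k = 0 := by
  simp [planeBivector, hk]

lemma planeProd_empty : planeProd a b ∅ = 1 := by simp [planeProd]

lemma planeProd_singleton : planeProd a b {k} = planeBivector a b k := by simp [planeProd]

namespace IsPrincipalSystem

variable (h : IsPrincipalSystem U W a b)

include h

lemma symm : IsPrincipalSystem W U b a where
  orthonormal_left := h.orthonormal_right
  orthonormal_right := h.orthonormal_left
  span_left := h.span_right
  span_right := h.span_left
  inner_ne k l hkl := by rw [real_inner_comm, h.inner_ne l k hkl.symm]
  inner_nonneg k := by rw [real_inner_comm]; exact h.inner_nonneg k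

lemma left_mem (k : Fin r) : a k ∈ U := h.span_left ▸ Submodule.subset_span ⟨k, rfl⟩

lemma principalPlane_le_sup (k : Fin r) : principalPlane a b k ≤ U ⊔ W :=
  Submodule.span_le.mpr <| by
    rintro _ (rfl | rfl)
    · exact Submodule.mem_sup_left (h.left_mem k)
    · exact Submodule.mem_sup_right (h.symm.left_mem k)

lemma isOrtho_principalPlane (hkl : k ≠ l) : principalPlane a b k ⟂ principalPlane a b l := by
  refine Submodule.isOrtho_span.mpr ?_
  rintro _ (rfl | rfl) _ (rfl | rfl)
  · exact h.orthonormal_left.2 hkl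
  · exact h.inner_ne k l hkl
  · exact h.symm.inner_ne k l hkl
  · exact h.orthonormal_right.2 hkl

lemma cos_ang (k : Fin r) : Real.cos (ang a b k) = ⟪a k, b k⟫ := by
  rw [ang, InnerProductGeometry.cos_angle, h.orthonormal_left.1, h.orthonormal_right.1, mul_one,
    div_one]

lemma ang_le_pi_div_two (k : Fin r) : ang a b k ≤ Real.pi / 2 :=
  Real.arccos_le_pi_div_two.mpr
    (div_nonneg (h.inner_nonneg k) (mul_nonneg (norm_nonneg _) (norm_nonneg _)))

lemma sin_ang_pos (hk : ang a b k ≠ 0) : 0 < Real.sin (ang a b k) :=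
  Real.sin_pos_of_pos_of_lt_pi (ang_nonneg.lt_of_ne' hk)
    (by linarith [h.ang_le_pi_div_two k, Real.pi_pos])

lemma prod_sin_ang_pos : 0 < ∏ k ∈ midIdx a b, Real.sin (ang a b k) :=
  Finset.prod_pos fun _ hk => h.sin_ang_pos (ang_ne_zero_of_mem_midIdx hk)

lemma left_eq_right_of_ang_eq_zero (hk : ang a b k = 0) : a k = b k :=
  (inner_eq_one_iff_of_norm_eq_one (h.orthonormal_left.1 k) (h.orthonormal_right.1 k)).mp <| by
    rw [← h.cos_ang, hk, Real.cos_zero]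

lemma parIdx_union_midIdx_union_perpIdx :
    parIdx a b ∪ midIdx a b ∪ perpIdx a b = Finset.univ := by
  ext k
  simp only [Finset.mem_univ, Finset.mem_union, mem_parIdx, mem_midIdx, mem_perpIdx, iff_true]
  rcases ang_nonneg.eq_or_lt with h0 | h0
  · exact Or.inl (Or.inl h0.symm)
  · exact (h.ang_le_pi_div_two k).lt_or_eq.imp (fun hlt => Or.inr ⟨h0, hlt⟩) id

lemma card_parIdx_add_card_midIdx_add_card_perpIdx :
    (parIdx a b).card + (midIdx a b).card + (perpIdx a b).card = r := by
  rw [← Finset.card_union_of_disjoint disjoint_parIdx_midIdx,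
    ← Finset.card_union_of_disjoint disjoint_parIdx_union_midIdx_perpIdx,
    h.parIdx_union_midIdx_union_perpIdx, Finset.card_fin]

lemma inner_left_planeNormal (k : Fin r) : ⟪a k, planeNormal a b k⟫ = 0 := by
  rw [planeNormal, real_inner_smul_right, inner_sub_right, real_inner_smul_right, h.cos_ang,
    real_inner_self_eq_norm_sq, h.orthonormal_left.1]
  ring

lemma norm_planeNormal (hk : ang a b k ≠ 0) : ‖planeNormal a b k‖ = 1 := by
  have hsin := h.sin_ang_pos hk
  have hsq : ‖b k - Real.cos (ang a b k) • a k‖ ^ 2 = Real.sin (ang a b k) ^ 2 := by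
    rw [norm_sub_sq_real, norm_smul, h.orthonormal_left.1, h.orthonormal_right.1,
      real_inner_smul_right, real_inner_comm, ← h.cos_ang, Real.sin_sq, Real.norm_eq_abs, mul_one,
      sq_abs]
    ring
  rw [planeNormal, norm_smul, (pow_left_inj₀ (norm_nonneg _) hsin.le two_ne_zero).mp hsq, norm_inv,
    Real.norm_of_nonneg hsin.le, inv_mul_cancel₀ hsin.ne']

lemma orthonormal_pair (hk : ang a b k ≠ 0) : Orthonormal ℝ ![a k, planeNormal a b k] := by
  simp [h.orthonormal_left.1 k, h.norm_planeNormal hk, h.inner_left_planeNormal k]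

lemma ι_mul_ι (k : Fin r) : ι (Q n) (a k) * ι (Q n) (b k) = planeRotor a b k := by
  by_cases hk : ang a b k = 0
  · rw [planeRotor, ← h.left_eq_right_of_ang_eq_zero hk, ι_sq_scalar,
      Q_apply_eq_one_of_norm_eq_one (h.orthonormal_left.1 k), hk, Real.cos_zero, Real.sin_zero,
      zero_smul, add_zero]
  · rw [planeRotor, planeBivector, outer_pair, h.cos_ang, smul_inv_smul₀ (h.sin_ang_pos hk).ne',
      add_sub_cancel]

lemma planeBivector_eq_outer (k : Fin r) :
    planeBivector a b k = outer ![a k, planeNormal a b k] := by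
  rw [planeBivector, outer_pair, outer_pair, h.inner_left_planeNormal, planeNormal, map_smul,
    map_sub, map_smul, mul_smul_comm, mul_sub, mul_smul_comm, ι_sq_scalar,
    Q_apply_eq_one_of_norm_eq_one (h.orthonormal_left.1 k), h.cos_ang, map_zero, sub_zero, map_one,
    Algebra.algebraMap_eq_smul_one]

lemma isNormedBlade_planeBivector (hk : ang a b k ≠ 0) : IsNormedBlade 2 (planeBivector a b k) :=
  h.planeBivector_eq_outer k ▸ isNormedBlade_outer (h.orthonormal_pair hk)

lemma bladeSpace_planeBivector_le (hk : ang a b k ≠ 0) :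
    bladeSpace (planeBivector a b k) ≤ principalPlane a b k := by
  rw [h.planeBivector_eq_outer, bladeSpace_outer (h.orthonormal_pair hk), Submodule.span_le]
  rintro _ ⟨i, rfl⟩
  fin_cases i
  · exact left_mem_principalPlane
  · exact planeNormal_mem_principalPlane

lemma pairwise_commute_planeBivector :
    Pairwise (Function.onFun Commute (planeBivector a b)) := fun k l hkl => by
  rw [Function.onFun]
  by_cases hk : ang a b k = 0
  · exact planeBivector_eq_zero hk ▸ Commute.zero_left _
  by_cases hl : ang a b l = 0
  · exact planeBivector_eq_zero hl ▸ Commute.zero_right _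
  exact (h.isNormedBlade_planeBivector hk).commute_of_even (h.isNormedBlade_planeBivector hl)
    ((h.isOrtho_principalPlane hkl).mono (h.bladeSpace_planeBivector_le hk)
      (h.bladeSpace_planeBivector_le hl)) even_two

lemma planeProd_eq_noncommProd (S : Finset (Fin r)) : planeProd a b S =
    S.noncommProd (planeBivector a b) (h.pairwise_commute_planeBivector.set_pairwise _) := by
  rw [planeProd, ← Finset.noncommProd_toFinset _ _ (h.pairwise_commute_planeBivector.set_pairwise _)
    (Finset.sort_nodup _ _)]
  exact Finset.noncommProd_congr (Finset.sort_toFinset _ _) (fun _ _ => rfl) _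

lemma planeProd_insert (hk : k ∉ S) :
    planeProd a b (insert k S) = planeBivector a b k * planeProd a b S := by
  rw [h.planeProd_eq_noncommProd, h.planeProd_eq_noncommProd,
    Finset.noncommProd_insert_of_notMem _ _ _ _ hk]

lemma planeProd_union (hST : Disjoint S T) :
    planeProd a b (S ∪ T) = planeProd a b S * planeProd a b T := by
  simp only [h.planeProd_eq_noncommProd]
  exact Finset.noncommProd_union_of_disjoint hST _ _

lemma isNormedBlade_planeProd_and_bladeSpace_le (hS : ∀ k ∈ S, ang a b k ≠ 0) :
    IsNormedBlade (2 * S.card) (planeProd a b S) ∧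
      bladeSpace (planeProd a b S) ≤ ⨆ k ∈ S, principalPlane a b k := by
  induction S using Finset.induction_on with
  | empty =>
    have he : Orthonormal ℝ (Fin.elim0 : Fin 0 → V n) := ⟨fun i => i.elim0, fun i => i.elim0⟩
    have hone : planeProd a b ∅ = outer (Fin.elim0 : Fin 0 → V n) := by
      rw [planeProd_empty, outer_eq_list_prod_of_orthonormal he]
      rfl
    exact hone ▸ ⟨isNormedBlade_outer he, by simp [bladeSpace_outer he]⟩
  | insert k S hk ih =>
    obtain ⟨hblade, hle⟩ := ih fun l hl => hS l (Finset.mem_insert_of_mem hl)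
    have hk0 := hS k (Finset.mem_insert_self k S)
    have hbladek := h.isNormedBlade_planeBivector hk0
    have hlek := h.bladeSpace_planeBivector_le hk0
    have hortho : bladeSpace (planeBivector a b k) ⟂ bladeSpace (planeProd a b S) := by
      refine Submodule.IsOrtho.mono hlek hle ?_
      simp only [Submodule.isOrtho_iSup_right]
      exact fun l hl => h.isOrtho_principalPlane fun hkl => hk (hkl ▸ hl)
    rw [h.planeProd_insert hk, Finset.card_insert_of_notMem hk, mul_add_one, add_comm (2 * _),
      hbladek.bladeSpace_mul hblade hortho, Finset.iSup_insert]
    exact ⟨hbladek.mul hblade hortho, sup_le_sup hlek hle⟩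

lemma isNormedBlade_planeProd (hS : ∀ k ∈ S, ang a b k ≠ 0) :
    IsNormedBlade (2 * S.card) (planeProd a b S) :=
  (h.isNormedBlade_planeProd_and_bladeSpace_le hS).1

lemma bladeSpace_planeProd_le_sup (hS : ∀ k ∈ S, ang a b k ≠ 0) :
    bladeSpace (planeProd a b S) ≤ U ⊔ W :=
  (h.isNormedBlade_planeProd_and_bladeSpace_le hS).2.trans
    (iSup₂_le fun k _ => h.principalPlane_le_sup k)

lemma outer_mul_reverse_outer_eq_list_prod :
    outer a * reverse (outer b) = ((List.finRange r).map (planeRotor a b)).prod := by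
  have hortho : (List.finRange r).Pairwise fun k l =>
      (Q n).IsOrtho (b k) (a l) ∧ (Q n).IsOrtho (b k) (b l) :=
    (List.nodup_finRange r).imp fun {k l} hkl => ⟨isOrtho_Q_iff.mpr (h.symm.inner_ne k l hkl),
      isOrtho_Q_iff.mpr (h.orthonormal_right.2 hkl)⟩
  rw [outer_eq_list_prod_of_orthonormal h.orthonormal_left,
    outer_eq_list_prod_of_orthonormal h.orthonormal_right, List.ofFn_eq_map, List.ofFn_eq_map,
    list_prod_mul_reverse_list_prod_of_isOrtho hortho]
  exact congrArg List.prod (List.map_congr_left fun k _ => h.ι_mul_ι k)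

lemma pairwise_commute_planeRotor : Pairwise (Function.onFun Commute (planeRotor a b)) :=
  pairwise_commute_algebraMap_add_smul h.pairwise_commute_planeBivector _ _

lemma noncommProd_planeRotor_parIdx :
    (parIdx a b).noncommProd (planeRotor a b) (h.pairwise_commute_planeRotor.set_pairwise _) =
      1 := by
  rw [Finset.noncommProd_eq_pow_card _ _ _ 1, one_pow]
  intro k hk
  simp [planeRotor, mem_parIdx.mp hk]

lemma noncommProd_planeRotor_midIdx :
    (midIdx a b).noncommProd (planeRotor a b) (h.pairwise_commute_planeRotor.set_pairwise _) =
      ∑ S ∈ (midIdx a b).powerset, ((∏ k ∈ S, Real.sin (ang a b k)) *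
        ∏ k ∈ midIdx a b \ S, Real.cos (ang a b k)) • planeProd a b S := by
  simp only [h.planeProd_eq_noncommProd]
  exact noncommProd_algebraMap_add_smul h.pairwise_commute_planeBivector _ _ _

lemma noncommProd_planeRotor_perpIdx :
    (perpIdx a b).noncommProd (planeRotor a b) (h.pairwise_commute_planeRotor.set_pairwise _) =
      planeProd a b (perpIdx a b) := by
  rw [h.planeProd_eq_noncommProd]
  refine Finset.noncommProd_congr rfl (fun k hk => ?_) _
  simp [planeRotor, mem_perpIdx.mp hk]

lemma outer_mul_reverse_outer : outer a * reverse (outer b) = rotorSum a b := by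
  have hcomm (S : Set (Fin r)) := h.pairwise_commute_planeRotor.set_pairwise S
  calc outer a * reverse (outer b)
      = (parIdx a b ∪ midIdx a b ∪ perpIdx a b).noncommProd (planeRotor a b) (hcomm _) := by
        rw [h.outer_mul_reverse_outer_eq_list_prod,
          ← Finset.noncommProd_toFinset _ _ (hcomm _) (List.nodup_finRange r)]
        exact Finset.noncommProd_congr
          (by rw [List.toFinset_finRange, h.parIdx_union_midIdx_union_perpIdx]) (fun _ _ => rfl) _
    _ = rotorSum a b := by
        rw [Finset.noncommProd_union_of_disjoint disjoint_parIdx_union_midIdx_perpIdx _ (hcomm _),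
          Finset.noncommProd_union_of_disjoint disjoint_parIdx_midIdx _ (hcomm _),
          h.noncommProd_planeRotor_parIdx, h.noncommProd_planeRotor_midIdx,
          h.noncommProd_planeRotor_perpIdx, one_mul, rotorSum]

end IsPrincipalSystem

end PrincipalSystem

section BladeFamily

variable {n m j : ℕ} {κ : Type*} {M : Finset κ} {Y : Finset κ → Cl n}

/-- `Y` assigns to each subset `S` of `M` a normed blade of grade `m + 2 |S|`. The grade parts of a
linear combination of such blades are read off from the sizes of the subsets. -/
def IsBladeFamily (M : Finset κ) (m : ℕ) (Y : Finset κ → Cl n) : Prop :=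
  ∀ S ⊆ M, IsNormedBlade (m + 2 * S.card) (Y S)

namespace IsBladeFamily

lemma scalarPart_sum (hY : IsBladeFamily M 0 Y) (w : Finset κ → ℝ) :
    scalarPart (∑ S ∈ M.powerset, w S • Y S) = w ∅ * scalarPart (Y ∅) := by
  rw [SubspaceAngles.scalarPart_sum, Finset.sum_eq_single_of_mem _ (Finset.empty_mem_powerset M),
    scalarPart_smul]
  intro S hS hne
  rw [scalarPart_smul, (hY S (Finset.mem_powerset.mp hS)).scalarPart_eq_zero (by simpa using hne),
    mul_zero]

variable (hY : IsBladeFamily M m Y) (w : Finset κ → ℝ)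

include hY

lemma gradePart_sum (j : ℕ) : gradePart j (∑ S ∈ M.powerset, w S • Y S) =
    ∑ S ∈ M.powerset with m + 2 * S.card = j, w S • Y S := by
  rw [SubspaceAngles.gradePart_sum, Finset.sum_filter]
  refine Finset.sum_congr rfl fun S hS => ?_
  rw [gradePart_smul, (hY S (Finset.mem_powerset.mp hS)).gradePart_eq, smul_ite, smul_zero]

lemma gradePart_sum_of_lt (hj : j < m) : gradePart j (∑ S ∈ M.powerset, w S • Y S) = 0 := by
  rw [hY.gradePart_sum, Finset.filter_false_of_mem fun S _ => by omega, Finset.sum_empty]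

lemma gradePart_sum_of_gt (hj : m + 2 * M.card < j) :
    gradePart j (∑ S ∈ M.powerset, w S • Y S) = 0 := by
  rw [hY.gradePart_sum, Finset.filter_false_of_mem fun S hS => ?_, Finset.sum_empty]
  have hcard := Finset.card_le_card (Finset.mem_powerset.mp hS)
  omega

lemma gradePart_sum_lowest : gradePart m (∑ S ∈ M.powerset, w S • Y S) = w ∅ • Y ∅ := by
  have hfilter : (M.powerset.filter fun S => m + 2 * S.card = m) = {∅} := by
    ext S
    simp +contextual
  rw [hY.gradePart_sum, hfilter, Finset.sum_singleton]

lemma gradePart_sum_highest :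
    gradePart (m + 2 * M.card) (∑ S ∈ M.powerset, w S • Y S) = w M • Y M := by
  have hfilter : (M.powerset.filter fun S => m + 2 * S.card = m + 2 * M.card) = {M} := by
    ext S
    simp only [Finset.mem_filter, Finset.mem_powerset, Finset.mem_singleton]
    exact ⟨fun hS => Finset.eq_of_subset_of_card_le hS.1 (by omega), by rintro rfl; simp⟩
  rw [hY.gradePart_sum, hfilter, Finset.sum_singleton]

lemma gradePart_sum_add_two :
    gradePart (m + 2) (∑ S ∈ M.powerset, w S • Y S) = ∑ k ∈ M, w {k} • Y {k} := by
  have hfilter : (M.powerset.filter fun S => m + 2 * S.card = m + 2) =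
      M.map ⟨singleton, Finset.singleton_injective⟩ := by
    rw [← Finset.powersetCard_one]
    ext S
    simp only [Finset.mem_filter, Finset.mem_powerset, Finset.mem_powersetCard]
    exact and_congr_right fun _ => by omega
  rw [hY.gradePart_sum, hfilter, Finset.sum_map]
  rfl

end IsBladeFamily

end BladeFamily

section RotorSum

open CliffordAlgebra

lemma sup_inf_eq_inf_of_isOrtho {𝕜 E : Type*} [RCLike 𝕜] [NormedAddCommGroup E]
    [InnerProductSpace 𝕜 E] {S U W : Submodule 𝕜 E} (hSU : S ⟂ U) (hSW : S ⟂ W) :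
    (S ⊔ U) ⊓ W = U ⊓ W := by
  refine le_antisymm (fun x hx => ?_) (inf_le_inf_right W le_sup_right)
  obtain ⟨y, hy, z, hz, rfl⟩ := Submodule.mem_sup.mp hx.1
  have hyy : inner 𝕜 y y = 0 := by
    simpa [inner_add_right, Submodule.isOrtho_iff_inner_eq.mp hSU y hy z hz] using
      Submodule.isOrtho_iff_inner_eq.mp hSW y hy _ hx.2
  rw [inner_self_eq_zero] at hyy
  rw [hyy, zero_add] at hx ⊢
  exact ⟨hz, hx.2⟩

variable {n q r j : ℕ} {U W : Submodule ℝ (V n)} {a b : Fin r → V n} {k : Fin r} {C : Cl n}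
  {x : V n}

/-- The product `∏ (1 + tan θₖ 𝐢ₖ)` over the principal angles strictly between `0` and `π / 2`, in
expanded form; it is the quotient of `A B̃` by its lowest non-zero grade part. -/
def tangentSum (a b : Fin r → V n) : Cl n :=
  ∑ S ∈ (midIdx a b).powerset, (∏ k ∈ S, Real.tan (ang a b k)) • planeProd a b S

lemma rotorSum_eq_prod_cos_smul :
    rotorSum a b = (∏ k ∈ midIdx a b, Real.cos (ang a b k)) •
      (tangentSum a b * planeProd a b (perpIdx a b)) := by
  rw [rotorSum, tangentSum, ← smul_mul_assoc, Finset.smul_sum]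
  congr 1
  refine Finset.sum_congr rfl fun S hS => ?_
  rw [Finset.mem_powerset] at hS
  have hsin : ∏ k ∈ S, Real.sin (ang a b k) =
      (∏ k ∈ S, Real.tan (ang a b k)) * ∏ k ∈ S, Real.cos (ang a b k) := by
    rw [← Finset.prod_mul_distrib]
    exact Finset.prod_congr rfl fun k hk => (Real.tan_mul_cos (cos_ang_pos (hS hk)).ne').symm
  rw [smul_smul, hsin, ← Finset.prod_sdiff hS]
  congr 1
  ring

namespace IsPrincipalSystem

variable (h : IsPrincipalSystem U W a b)

include h

lemma update_neg (hk : k ∈ perpIdx a b) :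
    IsPrincipalSystem U W a (Function.update b k (-b k)) where
  orthonormal_left := h.orthonormal_left
  orthonormal_right := orthonormal_update_neg h.orthonormal_right k
  span_left := h.span_left
  span_right := (span_range_update_neg b k).trans h.span_right
  inner_ne i j hij := by
    rcases eq_or_ne j k with rfl | hj
    · rw [Function.update_self, inner_neg_right, h.inner_ne i j hij, neg_zero]
    · rw [Function.update_of_ne hj, h.inner_ne i j hij]
  inner_nonneg i := by
    rcases eq_or_ne i k with rfl | hi
    · rw [Function.update_self, inner_neg_right, ← h.cos_ang, mem_perpIdx.mp hk,
        Real.cos_pi_div_two, neg_zero]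
    · rw [Function.update_of_ne hi]
      exact h.inner_nonneg i

lemma rotorSum_update_neg (hk : k ∈ perpIdx a b) :
    rotorSum a (Function.update b k (-b k)) = -rotorSum a b := by
  rw [← (h.update_neg hk).outer_mul_reverse_outer, ← h.outer_mul_reverse_outer, outer, outer,
    outer, AlternatingMap.map_update_neg, Function.update_eq_self, map_neg, map_neg, mul_neg]

lemma inner_right_eq_cos_mul (hx : x ∈ U) (k : Fin r) :
    ⟪b k, x⟫ = Real.cos (ang a b k) * ⟪a k, x⟫ := by
  rw [← h.span_left] at hx
  obtain ⟨c, rfl⟩ := (Submodule.mem_span_range_iff_exists_fun ℝ).mp hx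
  rw [h.orthonormal_left.inner_right_fintype, inner_sum,
    Finset.sum_eq_single_of_mem k (Finset.mem_univ k), real_inner_smul_right, real_inner_comm,
    h.cos_ang, mul_comm]
  intro l _ hlk
  rw [real_inner_smul_right, real_inner_comm, h.inner_ne l k hlk, mul_zero]

lemma inner_left_eq_zero_of_mem_inf (hx : x ∈ U ⊓ W) (hk : ang a b k ≠ 0) : ⟪a k, x⟫ = 0 := by
  have hcos : ⟪a k, x⟫ = Real.cos (ang a b k) * ⟪b k, x⟫ := by
    rw [h.symm.inner_right_eq_cos_mul hx.2, ang, ang, InnerProductGeometry.angle_comm]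
  have hsin : Real.sin (ang a b k) ^ 2 * ⟪a k, x⟫ = 0 := by
    rw [Real.sin_sq, sub_mul, one_mul, pow_two, mul_assoc, ← h.inner_right_eq_cos_mul hx.1, ← hcos,
      sub_self]
  exact (mul_eq_zero.mp hsin).resolve_left (pow_ne_zero 2 (h.sin_ang_pos hk).ne')

lemma inf_eq_span_parIdx :
    U ⊓ W = Submodule.span ℝ (Set.range fun k : parIdx a b => a k) := by
  refine le_antisymm (fun x hx => ?_) (Submodule.span_le.mpr ?_)
  · have hxU : x ∈ Submodule.span ℝ (Set.range a) := h.span_left ▸ hx.1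
    obtain ⟨c, rfl⟩ := (Submodule.mem_span_range_iff_exists_fun ℝ).mp hxU
    refine Submodule.sum_mem _ fun k _ => ?_
    by_cases hk : ang a b k = 0
    · exact Submodule.smul_mem _ _ (Submodule.subset_span ⟨⟨k, mem_parIdx.mpr hk⟩, rfl⟩)
    · have hck := h.inner_left_eq_zero_of_mem_inf hx hk
      rw [h.orthonormal_left.inner_right_fintype] at hck
      rw [hck, zero_smul]
      exact Submodule.zero_mem _
  · rintro _ ⟨⟨k, hk⟩, rfl⟩
    refine ⟨h.left_mem k, ?_⟩
    change a k ∈ W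
    exact h.left_eq_right_of_ang_eq_zero (mem_parIdx.mp hk) ▸ h.symm.left_mem k

lemma card_parIdx : (parIdx a b).card = Module.finrank ℝ ↥(U ⊓ W) := by
  rw [h.inf_eq_span_parIdx, ← Fintype.card_coe]
  exact (finrank_span_eq_card
    (h.orthonormal_left.linearIndependent.comp _ Subtype.val_injective)).symm

lemma isBladeFamily_planeProd : IsBladeFamily (midIdx a b) 0 (planeProd a b) := fun S hS => by
  rw [zero_add]
  exact h.isNormedBlade_planeProd fun k hk => ang_ne_zero_of_mem_midIdx (hS hk)

lemma sub_card_perpIdx_sub_card_parIdx :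
    r - (perpIdx a b).card - (parIdx a b).card = (midIdx a b).card := by
  have hcard := h.card_parIdx_add_card_midIdx_add_card_perpIdx
  omega

lemma gradePart_tangentSum_of_gt (hj : 2 * (r - (perpIdx a b).card - (parIdx a b).card) < j) :
    gradePart j (tangentSum a b) = 0 :=
  h.isBladeFamily_planeProd.gradePart_sum_of_gt _
    (by rwa [zero_add, ← h.sub_card_perpIdx_sub_card_parIdx])

lemma gradePart_tangentSum_highest_ne_zero :
    gradePart (2 * (r - (perpIdx a b).card - (parIdx a b).card)) (tangentSum a b) ≠ 0 := by
  rw [h.sub_card_perpIdx_sub_card_parIdx, ← zero_add (2 * _), tangentSum,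
    h.isBladeFamily_planeProd.gradePart_sum_highest]
  exact smul_ne_zero prod_tan_ang_pos.ne' (h.isBladeFamily_planeProd _ subset_rfl).ne_zero

lemma gradePart_two_tangentSum : gradePart 2 (tangentSum a b) =
    ∑ k ∈ midIdx a b, Real.tan (ang a b k) • planeBivector a b k := by
  simpa only [tangentSum, Finset.prod_singleton, planeProd_singleton, zero_add] using
    h.isBladeFamily_planeProd.gradePart_sum_add_two fun S => ∏ k ∈ S, Real.tan (ang a b k)

lemma scalarPart_tangentSum : scalarPart (tangentSum a b) = 1 := by
  rw [tangentSum, h.isBladeFamily_planeProd.scalarPart_sum, Finset.prod_empty, planeProd_empty,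
    scalarPart_one, one_mul]

lemma scalarPart_rotorSum_pos (hP : perpIdx a b = ∅) : 0 < scalarPart (rotorSum a b) := by
  rw [rotorSum_eq_prod_cos_smul, hP, planeProd_empty, mul_one, scalarPart_smul,
    h.scalarPart_tangentSum, mul_one]
  exact prod_cos_ang_pos

lemma sub_card_parIdx : r - (parIdx a b).card = (perpIdx a b).card + (midIdx a b).card := by
  have hcard := h.card_parIdx_add_card_midIdx_add_card_perpIdx
  omega

lemma mul_rotorSum_eq_sum (C : Cl n) : C * rotorSum a b = ∑ S ∈ (midIdx a b).powerset,
    ((∏ k ∈ S, Real.sin (ang a b k)) * ∏ k ∈ midIdx a b \ S, Real.cos (ang a b k)) •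
      (C * planeProd a b (S ∪ perpIdx a b)) := by
  rw [rotorSum, Finset.sum_mul, Finset.mul_sum]
  refine Finset.sum_congr rfl fun S hS => ?_
  rw [smul_mul_assoc, mul_smul_comm,
    h.planeProd_union (disjoint_midIdx_perpIdx.mono_left (Finset.mem_powerset.mp hS))]

lemma commute_tangentSum_planeProd_perpIdx :
    Commute (tangentSum a b) (planeProd a b (perpIdx a b)) := by
  refine Commute.sum_left _ _ _ fun S hS => Commute.smul_left ?_ _
  have hdisj := disjoint_midIdx_perpIdx.mono_left (Finset.mem_powerset.mp hS)
  rw [commute_iff_eq, ← h.planeProd_union hdisj, Finset.union_comm, h.planeProd_union hdisj.symm]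

section LeftMul

variable (hC : IsNormedBlade q C) (hCUW : bladeSpace C ⟂ U ⊔ W)

include hC hCUW

lemma isBladeFamily_mul_planeProd : IsBladeFamily (midIdx a b) (2 * (perpIdx a b).card + q)
    fun S => C * planeProd a b (S ∪ perpIdx a b) := fun S hS => by
  have hne : ∀ k ∈ S ∪ perpIdx a b, ang a b k ≠ 0 := fun k hk =>
    (Finset.mem_union.mp hk).elim (fun hk => ang_ne_zero_of_mem_midIdx (hS hk))
      ang_ne_zero_of_mem_perpIdx
  have hmul := hC.mul (h.isNormedBlade_planeProd hne)
    (hCUW.mono_right (h.bladeSpace_planeProd_le_sup hne))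
  rw [Finset.card_union_of_disjoint (disjoint_midIdx_perpIdx.mono_left hS)] at hmul
  convert hmul using 1
  ring

lemma isNormedBlade_mul_planeProd_perpIdx :
    IsNormedBlade (2 * (perpIdx a b).card + q) (C * planeProd a b (perpIdx a b)) := by
  simpa using h.isBladeFamily_mul_planeProd hC hCUW ∅ (Finset.empty_subset _)

lemma gradePart_mul_rotorSum_of_lt (hj : j < 2 * (perpIdx a b).card + q) :
    gradePart j (C * rotorSum a b) = 0 := by
  rw [h.mul_rotorSum_eq_sum, (h.isBladeFamily_mul_planeProd hC hCUW).gradePart_sum_of_lt _ hj]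

lemma gradePart_mul_rotorSum_of_gt (hj : 2 * (r - (parIdx a b).card) + q < j) :
    gradePart j (C * rotorSum a b) = 0 := by
  rw [h.sub_card_parIdx] at hj
  rw [h.mul_rotorSum_eq_sum,
    (h.isBladeFamily_mul_planeProd hC hCUW).gradePart_sum_of_gt _ (by omega)]

lemma gradePart_mul_rotorSum_lowest :
    gradePart (2 * (perpIdx a b).card + q) (C * rotorSum a b) =
      (∏ k ∈ midIdx a b, Real.cos (ang a b k)) • (C * planeProd a b (perpIdx a b)) := by
  rw [h.mul_rotorSum_eq_sum, (h.isBladeFamily_mul_planeProd hC hCUW).gradePart_sum_lowest,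
    Finset.prod_empty, one_mul, Finset.sdiff_empty, Finset.empty_union]

lemma magnitude_gradePart_mul_rotorSum_highest :
    magnitude (gradePart (2 * (r - (parIdx a b).card) + q) (C * rotorSum a b)) =
      ∏ k ∈ midIdx a b, Real.sin (ang a b k) := by
  have hblade := h.isBladeFamily_mul_planeProd hC hCUW
  rw [h.sub_card_parIdx, mul_add, add_right_comm, h.mul_rotorSum_eq_sum,
    hblade.gradePart_sum_highest, magnitude_smul, (hblade _ subset_rfl).2, mul_one,
    Finset.sdiff_self, Finset.prod_empty, mul_one, abs_of_pos h.prod_sin_ang_pos]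

lemma commute_tangentSum : Commute (tangentSum a b) C := by
  refine Commute.sum_left _ _ _ fun S hS => Commute.smul_left ?_ _
  have hne : ∀ k ∈ S, ang a b k ≠ 0 := fun k hk =>
    ang_ne_zero_of_mem_midIdx (Finset.mem_powerset.mp hS hk)
  exact (h.isNormedBlade_planeProd hne).commute_of_even hC
    (hCUW.mono_right (h.bladeSpace_planeProd_le_sup hne)).symm (even_two_mul _)

lemma mul_rotorSum_eq_tangentSum_mul : C * rotorSum a b = tangentSum a b *
    ((∏ k ∈ midIdx a b, Real.cos (ang a b k)) • (C * planeProd a b (perpIdx a b))) := by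
  rw [rotorSum_eq_prod_cos_smul, mul_smul_comm, mul_smul_comm, ← mul_assoc, ← mul_assoc,
    (h.commute_tangentSum hC hCUW).eq]

end LeftMul

end IsPrincipalSystem

end RotorSum

section Factorization

open CliffordAlgebra

variable {n q r j : ℕ} {A B A₁ A₂ A₁' A₂' : Cl n} {a b a' b' : Fin r → V n}

lemma IsPrincipalSystem.mul_reverse_eq_or_eq_neg
    (h : IsPrincipalSystem (bladeSpace A) (bladeSpace B) a b) (hA : IsNormedBlade r A)
    (hB : IsNormedBlade r B) :
    A * reverse B = rotorSum a b ∨ A * reverse B = -rotorSum a b := by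
  have hAa := hA.eq_or_eq_neg (isNormedBlade_outer h.orthonormal_left)
    (by rw [bladeSpace_outer h.orthonormal_left, h.span_left])
  have hBb := hB.eq_or_eq_neg (isNormedBlade_outer h.orthonormal_right)
    (by rw [bladeSpace_outer h.orthonormal_right, h.span_right])
  rw [← h.outer_mul_reverse_outer]
  rcases hAa with hA | hA <;> rcases hBb with hB | hB <;> simp [hA, hB]

namespace IsFactorization

variable (hfac : IsFactorization q r A B A₁ A₂) (hB : IsNormedBlade r B)
  (h : IsPrincipalSystem (bladeSpace A₂) (bladeSpace B) a b)

include hfac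

lemma isOrtho_bladeSpace_right : bladeSpace A₁ ⟂ bladeSpace A₂ :=
  hfac.orth_right.isOrtho_bladeSpace hfac.normed_right.ne_zero

lemma bladeSpace_eq_sup : bladeSpace A = bladeSpace A₁ ⊔ bladeSpace A₂ :=
  hfac.eq_mul ▸ hfac.normed_left.bladeSpace_mul hfac.normed_right hfac.isOrtho_bladeSpace_right

include hB

lemma isOrtho_bladeSpace_sup : bladeSpace A₁ ⟂ bladeSpace A₂ ⊔ bladeSpace B :=
  Submodule.isOrtho_sup_right.mpr
    ⟨hfac.isOrtho_bladeSpace_right, hfac.orth_blade.isOrtho_bladeSpace hB.ne_zero⟩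

lemma exists_eq_mul_rotorSum (h0 : 0 ≤ scalarPart (A₂ * reverse B)) :
    ∃ a b : Fin r → V n, IsPrincipalSystem (bladeSpace A₂) (bladeSpace B) a b ∧
      A * reverse B = A₁ * rotorSum a b := by
  rw [hfac.eq_mul, mul_assoc]
  obtain ⟨a, b, h⟩ :=
    exists_isPrincipalSystem hfac.normed_right.finrank_bladeSpace hB.finrank_bladeSpace
  rcases h.mul_reverse_eq_or_eq_neg hfac.normed_right hB with hX | hX
  · exact ⟨a, b, h, by rw [hX]⟩
  · obtain ⟨k, hk⟩ : (perpIdx a b).Nonempty := by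
      by_contra! hP
      rw [hX, ← neg_one_smul ℝ, scalarPart_smul] at h0
      linarith [h.scalarPart_rotorSum_pos hP]
    exact ⟨a, _, h.update_neg hk, by rw [hX, h.rotorSum_update_neg hk]⟩

include h

lemma exists_sign_eq_mul_rotorSum : ∃ ε : ℝ, (ε = 1 ∨ ε = -1) ∧
    A * reverse B = ε • (A₁ * rotorSum a b) ∧
    gradePart (2 * (perpIdx a b).card + q) (A * reverse B) =
      (ε * ∏ k ∈ midIdx a b, Real.cos (ang a b k)) • (A₁ * planeProd a b (perpIdx a b)) := by
  obtain ⟨ε, hε, hX⟩ : ∃ ε : ℝ, (ε = 1 ∨ ε = -1) ∧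
      A * reverse B = ε • (A₁ * rotorSum a b) := by
    rw [hfac.eq_mul, mul_assoc]
    rcases h.mul_reverse_eq_or_eq_neg hfac.normed_right hB with hX | hX
    · exact ⟨1, Or.inl rfl, by rw [hX, one_smul]⟩
    · exact ⟨-1, Or.inr rfl, by rw [hX, mul_neg, neg_one_smul]⟩
  refine ⟨ε, hε, hX, ?_⟩
  rw [hX, gradePart_smul, h.gradePart_mul_rotorSum_lowest hfac.normed_left
    (hfac.isOrtho_bladeSpace_sup hB), smul_smul]

lemma gradePart_of_lt (hj : j < 2 * (perpIdx a b).card + q) :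
    gradePart j (A * reverse B) = 0 := by
  obtain ⟨ε, -, hX, -⟩ := hfac.exists_sign_eq_mul_rotorSum hB h
  rw [hX, gradePart_smul, h.gradePart_mul_rotorSum_of_lt hfac.normed_left
    (hfac.isOrtho_bladeSpace_sup hB) hj, smul_zero]

lemma gradePart_of_gt (hj : 2 * (r - (parIdx a b).card) + q < j) :
    gradePart j (A * reverse B) = 0 := by
  obtain ⟨ε, -, hX, -⟩ := hfac.exists_sign_eq_mul_rotorSum hB h
  rw [hX, gradePart_smul, h.gradePart_mul_rotorSum_of_gt hfac.normed_left
    (hfac.isOrtho_bladeSpace_sup hB) hj, smul_zero]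

lemma isUnit_gradePart_lowest :
    IsUnit (gradePart (2 * (perpIdx a b).card + q) (A * reverse B)) := by
  obtain ⟨ε, hε, -, hL⟩ := hfac.exists_sign_eq_mul_rotorSum hB h
  have hε0 : ε ≠ 0 := by rcases hε with rfl | rfl <;> norm_num
  rw [hL]
  exact (h.isNormedBlade_mul_planeProd_perpIdx hfac.normed_left
    (hfac.isOrtho_bladeSpace_sup hB)).isUnit.smul
      (Units.mk0 _ (mul_ne_zero hε0 prod_cos_ang_pos.ne'))

lemma magnitude_gradePart_lowest :
    magnitude (gradePart (2 * (perpIdx a b).card + q) (A * reverse B)) =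
      ∏ k ∈ midIdx a b, Real.cos (ang a b k) := by
  obtain ⟨ε, hε, -, hL⟩ := hfac.exists_sign_eq_mul_rotorSum hB h
  have hεabs : |ε| = 1 := abs_eq zero_le_one |>.mpr hε
  rw [hL, magnitude_smul, (h.isNormedBlade_mul_planeProd_perpIdx hfac.normed_left
    (hfac.isOrtho_bladeSpace_sup hB)).2, mul_one, abs_mul, hεabs, one_mul,
    abs_of_pos prod_cos_ang_pos]

lemma magnitude_gradePart_highest :
    magnitude (gradePart (2 * (r - (parIdx a b).card) + q) (A * reverse B)) =
      ∏ k ∈ midIdx a b, Real.sin (ang a b k) := by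
  obtain ⟨ε, hε, hX, -⟩ := hfac.exists_sign_eq_mul_rotorSum hB h
  have hεabs : |ε| = 1 := abs_eq zero_le_one |>.mpr hε
  rw [hX, gradePart_smul, magnitude_smul, hεabs, one_mul,
    h.magnitude_gradePart_mul_rotorSum_highest hfac.normed_left (hfac.isOrtho_bladeSpace_sup hB)]

lemma gradePart_highest_ne_zero :
    gradePart (2 * (r - (parIdx a b).card) + q) (A * reverse B) ≠ 0 := fun h0 =>
  h.prod_sin_ang_pos.ne <| by
    rw [← hfac.magnitude_gradePart_highest hB h, h0, magnitude, zero_mul, scalarPart, map_zero,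
      map_zero, Real.sqrt_zero]

lemma commute_tangentSum_gradePart_lowest :
    Commute (tangentSum a b) (gradePart (2 * (perpIdx a b).card + q) (A * reverse B)) := by
  obtain ⟨ε, -, -, hL⟩ := hfac.exists_sign_eq_mul_rotorSum hB h
  exact hL ▸ ((h.commute_tangentSum hfac.normed_left (hfac.isOrtho_bladeSpace_sup hB)).mul_right
    h.commute_tangentSum_planeProd_perpIdx).smul_right _

lemma tangentSum_mul_gradePart_lowest :
    tangentSum a b * gradePart (2 * (perpIdx a b).card + q) (A * reverse B) = A * reverse B := by
  obtain ⟨ε, -, hX, hL⟩ := hfac.exists_sign_eq_mul_rotorSum hB h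
  rw [hL, hX, h.mul_rotorSum_eq_tangentSum_mul hfac.normed_left (hfac.isOrtho_bladeSpace_sup hB),
    mul_smul, mul_smul_comm]

lemma mul_inverse_gradePart_lowest :
    A * reverse B * Ring.inverse (gradePart (2 * (perpIdx a b).card + q) (A * reverse B)) =
      tangentSum a b := by
  nth_rewrite 1 [← hfac.tangentSum_mul_gradePart_lowest hB h]
  exact Ring.mul_inverse_cancel_right _ _ (hfac.isUnit_gradePart_lowest hB h)

lemma inverse_gradePart_lowest_mul :
    Ring.inverse (gradePart (2 * (perpIdx a b).card + q) (A * reverse B)) * (A * reverse B) =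
      tangentSum a b := by
  nth_rewrite 2 [← hfac.tangentSum_mul_gradePart_lowest hB h]
  rw [(hfac.commute_tangentSum_gradePart_lowest hB h).eq]
  exact Ring.inverse_mul_cancel_left _ _ (hfac.isUnit_gradePart_lowest hB h)

lemma card_parIdx_eq_finrank :
    (parIdx a b).card = Module.finrank ℝ ↥(bladeSpace A ⊓ bladeSpace B) := by
  rw [hfac.bladeSpace_eq_sup, sup_inf_eq_inf_of_isOrtho hfac.isOrtho_bladeSpace_right
    (hfac.orth_blade.isOrtho_bladeSpace hB.ne_zero), h.card_parIdx]

lemma card_perpIdx_le (hfac' : IsFactorization q r A B A₁' A₂')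
    (h' : IsPrincipalSystem (bladeSpace A₂') (bladeSpace B) a' b') :
    (perpIdx a b).card ≤ (perpIdx a' b').card := by
  by_contra! hlt
  exact (hfac'.isUnit_gradePart_lowest hB h').ne_zero (hfac.gradePart_of_lt hB h (by omega))

end IsFactorization

end Factorization

section Splitting

open CliffordAlgebra

variable {n r : ℕ}

lemma contract_outer_pair (x u v : V n) :
    contract x (outer ![u, v]) = ι (Q n) (⟪x, u⟫ • v - ⟪x, v⟫ • u) := by
  have hv : contract x (ι (Q n) v) = algebraMap ℝ _ ⟪x, v⟫ := contractLeft_ι _ _ v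
  have hc : contract x (algebraMap ℝ _ ⟪u, v⟫) = 0 := contractLeft_algebraMap _ _ _
  rw [contract] at hc
  rw [outer_pair, contract, map_sub, hc, sub_zero, ← contract, contract_ι_mul, hv, map_sub,
    map_smul, map_smul, ← Algebra.commutes, ← Algebra.smul_def]

lemma contract_sum_smul_outer_pair {κ : Type*} [Fintype κ] (τ : κ → ℝ) (u v : κ → V n) (x : V n) :
    contract x (∑ j, τ j • outer ![u j, v j]) = ι (Q n) (bivectorEnd τ u v x) := by
  simp only [bivectorEnd_apply, map_sum, map_smul, ← contract_outer_pair]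
  simp only [contract, map_sum, map_smul]

lemma IsSplitting.multiset_map_eq {κ κ' : Type} [Fintype κ] [Fintype κ'] {F : Cl n} {τ : κ → ℝ}
    {τ' : κ' → ℝ} {J : κ → Cl n} {J' : κ' → Cl n} (h : IsSplitting F τ J)
    (h' : IsSplitting F τ' J') :
    (Finset.univ : Finset κ).val.map τ = (Finset.univ : Finset κ').val.map τ' := by
  obtain ⟨⟨u, v, huv, hJ⟩, hτ, hF⟩ := h
  obtain ⟨⟨u', v', huv', hJ'⟩, hτ', hF'⟩ := h'
  refine multiset_map_eq_of_bivectorEnd_eq huv huv' hτ hτ' (ContinuousLinearMap.ext fun x => ?_)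
  refine ι_injective (Q := Q n) ?_
  rw [← contract_sum_smul_outer_pair, ← contract_sum_smul_outer_pair]
  simp only [← hJ, ← hJ', ← hF, ← hF']

namespace IsPrincipalSystem

variable {U W : Submodule ℝ (V n)} {a b : Fin r → V n} (h : IsPrincipalSystem U W a b)

include h

lemma orthonormal_left_planeNormal_midIdx :
    Orthonormal ℝ
      (Sum.elim (fun k : midIdx a b => a k) fun k : midIdx a b => planeNormal a b k) := by
  refine orthonormal_sumElim (h.orthonormal_left.comp _ Subtype.val_injective)
    ⟨fun k => h.norm_planeNormal (ang_ne_zero_of_mem_midIdx k.2), fun k l hkl => ?_⟩ fun k l => ?_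
  · exact Submodule.isOrtho_iff_inner_eq.mp (h.isOrtho_principalPlane (Subtype.coe_ne_coe.mpr hkl))
      _ planeNormal_mem_principalPlane _ planeNormal_mem_principalPlane
  · rcases eq_or_ne k l with rfl | hkl
    · exact h.inner_left_planeNormal k
    · exact Submodule.isOrtho_iff_inner_eq.mp
        (h.isOrtho_principalPlane (Subtype.coe_ne_coe.mpr hkl))
        _ left_mem_principalPlane _ planeNormal_mem_principalPlane

lemma isSplitting : IsSplitting (∑ k ∈ midIdx a b, Real.tan (ang a b k) • planeBivector a b k)
    (fun k : midIdx a b => Real.tan (ang a b k)) (fun k : midIdx a b => planeBivector a b k) :=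
  ⟨⟨_, _, h.orthonormal_left_planeNormal_midIdx, fun k => h.planeBivector_eq_outer k⟩,
    fun k => tan_ang_pos k.2, (Finset.sum_coe_sort _ _).symm⟩

lemma map_arctan_eq {κ : Type} [Fintype κ] {τ : κ → ℝ} {J : κ → Cl n}
    (hJ : IsSplitting (∑ k ∈ midIdx a b, Real.tan (ang a b k) • planeBivector a b k) τ J) :
    (Finset.univ : Finset κ).val.map (fun j => Real.arctan (τ j)) =
      (midIdx a b).val.map (ang a b) := by
  have harctan : ∀ k ∈ (midIdx a b).val, Real.arctan (Real.tan (ang a b k)) = ang a b k :=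
    fun k hk => Real.arctan_tan (by linarith [Real.pi_pos, ang_nonneg (a := a) (b := b) (k := k)])
      (mem_midIdx.mp hk).2
  have hτ := congrArg (Multiset.map Real.arctan) (hJ.multiset_map_eq h.isSplitting)
  rw [Multiset.map_map, Multiset.map_map] at hτ
  refine hτ.trans ?_
  rw [Finset.univ_eq_attach, Finset.attach_val, ← Multiset.map_congr rfl harctan]
  exact Multiset.attach_map_val' _ fun k => Real.arctan (Real.tan (ang a b k))

end IsPrincipalSystem

end Splitting

end SubspaceAngles

end

theorem mainTheorem4 (n q r : ℕ) (A B A₁ A₂ : SubspaceAngles.Cl n)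
    (hA : SubspaceAngles.IsNormedBlade (r + q) A)
    (hB : SubspaceAngles.IsNormedBlade r B)
    (hfac : SubspaceAngles.IsFactorization q r A B A₁ A₂) :
    -- principal vectors exist
    (∃ a b : Fin r → SubspaceAngles.V n,
      SubspaceAngles.IsPrincipalSystem
        (SubspaceAngles.bladeSpace A₂) (SubspaceAngles.bladeSpace B) a b) ∧
    -- for compatibly oriented blades they can be chosen such that the formula holds exactly
    (0 ≤ SubspaceAngles.scalarPart (A₂ * CliffordAlgebra.reverse B) →
      ∃ a b : Fin r → SubspaceAngles.V n,
        SubspaceAngles.IsPrincipalSystem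
          (SubspaceAngles.bladeSpace A₂) (SubspaceAngles.bladeSpace B) a b ∧
        A * CliffordAlgebra.reverse B = A₁ * SubspaceAngles.rotorSum a b) ∧
    -- every choice of principal vectors
    ∀ a b : Fin r → SubspaceAngles.V n,
      SubspaceAngles.IsPrincipalSystem
        (SubspaceAngles.bladeSpace A₂) (SubspaceAngles.bladeSpace B) a b →
      ∀ (s t : ℕ) (X L W F : SubspaceAngles.Cl n),
        s = (SubspaceAngles.parIdx a b).card →
        t = (SubspaceAngles.perpIdx a b).card →
        X = A * CliffordAlgebra.reverse B →
        L = SubspaceAngles.gradePart (2 * t + q) X →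
        W = X * Ring.inverse L →
        F = SubspaceAngles.gradePart 2 W →
        -- `s` is the dimension of the intersection, and `t` does not depend on the factorization
        s = Module.finrank ℝ
          ↥(SubspaceAngles.bladeSpace A ⊓ SubspaceAngles.bladeSpace B) ∧
        (∀ A₁' A₂' : SubspaceAngles.Cl n, SubspaceAngles.IsFactorization q r A B A₁' A₂' →
          ∀ a' b' : Fin r → SubspaceAngles.V n,
            SubspaceAngles.IsPrincipalSystem
              (SubspaceAngles.bladeSpace A₂') (SubspaceAngles.bladeSpace B) a' b' →
            (SubspaceAngles.perpIdx a' b').card = t) ∧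
        (∃ ε : ℝ, (ε = 1 ∨ ε = -1) ∧
          -- the product formula, up to the relative orientation `ε`
          X = ε • (A₁ * SubspaceAngles.rotorSum a b) ∧
          -- the lowest non-zero grade part
          L = (ε * ∏ k ∈ SubspaceAngles.midIdx a b, Real.cos (SubspaceAngles.ang a b k)) •
            (A₁ * SubspaceAngles.planeProd a b (SubspaceAngles.perpIdx a b))) ∧
        (∀ j < 2 * t + q, SubspaceAngles.gradePart j X = 0) ∧
        L ≠ 0 ∧
        SubspaceAngles.magnitude L =
          ∏ k ∈ SubspaceAngles.midIdx a b, Real.cos (SubspaceAngles.ang a b k) ∧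
        -- the highest non-zero grade part
        (∀ j > 2 * (r - s) + q, SubspaceAngles.gradePart j X = 0) ∧
        SubspaceAngles.gradePart (2 * (r - s) + q) X ≠ 0 ∧
        SubspaceAngles.magnitude (SubspaceAngles.gradePart (2 * (r - s) + q) X) =
          ∏ k ∈ SubspaceAngles.midIdx a b, Real.sin (SubspaceAngles.ang a b k) ∧
        -- division by the lowest non-zero grade part, on either side
        IsUnit L ∧
        W = Ring.inverse L * X ∧
        (∀ j > 2 * (r - t - s), SubspaceAngles.gradePart j W = 0) ∧
        SubspaceAngles.gradePart (2 * (r - t - s)) W ≠ 0 ∧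
        SubspaceAngles.scalarPart W = 1 ∧
        F = ∑ k ∈ SubspaceAngles.midIdx a b,
          Real.tan (SubspaceAngles.ang a b k) • SubspaceAngles.planeBivector a b k ∧
        -- the principal angles are read off from any orthogonal splitting of the bivector part
        SubspaceAngles.IsSplitting F
          (fun k : ↥(SubspaceAngles.midIdx a b) => Real.tan (SubspaceAngles.ang a b k))
          (fun k : ↥(SubspaceAngles.midIdx a b) => SubspaceAngles.planeBivector a b k) ∧
        ∀ (m : ℕ) (τ : Fin m → ℝ) (J : Fin m → SubspaceAngles.Cl n),
          SubspaceAngles.IsSplitting F τ J →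
          (Finset.univ : Finset (Fin m)).val.map (fun j => Real.arctan (τ j)) =
            (SubspaceAngles.midIdx a b).val.map (SubspaceAngles.ang a b) := by
  refine ⟨SubspaceAngles.exists_isPrincipalSystem hfac.normed_right.finrank_bladeSpace
    hB.finrank_bladeSpace, hfac.exists_eq_mul_rotorSum hB, ?_⟩
  rintro a b h s t X L W F rfl rfl rfl rfl hW rfl
  obtain rfl : W = SubspaceAngles.tangentSum a b :=
    hW.trans (hfac.mul_inverse_gradePart_lowest hB h)
  have hL := hfac.isUnit_gradePart_lowest hB h
  obtain ⟨ε, hε, hX, hLε⟩ := hfac.exists_sign_eq_mul_rotorSum hB h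
  rw [h.gradePart_two_tangentSum]
  exact ⟨hfac.card_parIdx_eq_finrank hB h,
    fun A₁' A₂' hfac' a' b' h' => le_antisymm (hfac'.card_perpIdx_le hB h' hfac h)
      (hfac.card_perpIdx_le hB h hfac' h'),
    ⟨ε, hε, hX, hLε⟩,
    fun j hj => hfac.gradePart_of_lt hB h hj, hL.ne_zero, hfac.magnitude_gradePart_lowest hB h,
    fun j hj => hfac.gradePart_of_gt hB h hj, hfac.gradePart_highest_ne_zero hB h,
    hfac.magnitude_gradePart_highest hB h,
    hL, (hfac.inverse_gradePart_lowest_mul hB h).symm,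
    fun j hj => h.gradePart_tangentSum_of_gt hj, h.gradePart_tangentSum_highest_ne_zero,
    h.scalarPart_tangentSum, rfl, h.isSplitting, fun m τ J hJ => h.map_arctan_eq hJ⟩
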